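/- **Calculus.** Values and terms of the probabilistic call-by-value $\lambda$-calculus are given by $V::=x\mid\lambda x.M$ and $M::=V\mid VV\mid M\oplus M\mid \mathtt{let}\ x=M\ \mathtt{in}\ M$. One-step reduction maps terms to finite multidistributions: $(\lambda x.M)V\to\langle M\{V/x\}\rangle$; $\mathtt{let}\ x=V\ \mathtt{in}\ M\to\langle M\{V/x\}\rangle$; $M\oplus N\to\langle\frac12M,\frac12N\rangle$; and if $N\to\langle p_iN_i\rangle_{i\in I}$ then $\mathtt{let}\ x=N\ \mathtt{in}\ M\to\langle p_i\,(\mathtt{let}\ x=N_i\ \mathtt{in}\ M)\rangle_{i\in I}$. It is lifted to multidistributions by reducing all non-values simultaneously and keeping the values. For a closed term $M$ and a value $V$ let $E_k(M,V)$ be the total weight of $V$ in the $k$-th multidistribution of the reduction sequence of $\langle M\rangle$ (the probability that $M$ evaluates to $V$ within $k$ steps), and let $[\![M]\!](V)=\sup_kE_k(M,V)$. The CPS fragment is given by $V::=x\mid\lambda x.M$ and $M::=V\mid MV\mid M\oplus M$, where $MV$ abbreviates $\mathtt{let}\ x=M\ \mathtt{in}\ xV$ with $x$ fresh. **Machines.**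 A probabilistic Turing machine $\mathcal M$ has one two-way infinite tape, a finite tape alphabet $\Sigma=\{a_1,\dots,a_m\}$ with a distinguished blank, a finite set $Q$ of states with an initial state, and a partial transition function $\delta$ that maps a state and a scanned symbol to two elements of $Q\times\Sigma\times\{\leftarrow,\downarrow,\rightarrow\}$ (possibly equal), each of which is taken with probability $\frac12$; $\mathcal M$ halts when $\delta$ is undefined. On input $s\in\Sigma^*$ the tape contains $s$, all other cells being blank, and the head starts on the first cell of $s$ (on a blank cell if $s=\varepsilon$). The output is the content of the tape segment formed by the input cells and the visited cells. Let $P_k(\mathcal M,s,w)$ be the probability that $\mathcal M$ on input $s$ halts with output $w$ within $k$ steps, and let $[\![\mathcal M]\!]_s(w)=\sup_kP_k(\mathcal M,s,w)$. **Encoding of strings.** $\overline\varepsilon=\lambda x_1.\cdots\lambda x_m.\lambda y.y$ and $\overline{a_i\cdot s}=\lambda x_1.\cdots\lambda x_m.\lambda y.x_i\,\overline s$. **Theorem.** There is a map $\mathcal M\mapsto T_{\mathcal M}$ from probabilistic Turing machines to closed terms of the CPS fragment which is effective (a computable function maps the code of $\mathcal M$ to the Gödel number of $T_{\mathcal M}$)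 and such that, for every $\mathcal M$: 1. for every $s\in\Sigma^*$ the evaluation of $T_{\mathcal M}\,\overline s$ produces the same distribution as the computation of $\mathcal M$ on $s$, up to encodings: for every value $V$, $$[\![T_{\mathcal M}\,\overline s]\!](V)=\sum_{w\in\Sigma^*,\ \overline w=V}[\![\mathcal M]\!]_s(w);$$ 2. the numbers of steps are linearly related: there are $a,b\in\mathbb N$, depending only on $\mathcal M$, such that for all $s,w\in\Sigma^*$ and all $k\in\mathbb N$ $$P_k(\mathcal M,s,w)\le E_{ak+b}(T_{\mathcal M}\,\overline s,\overline w)\qquad\text{and}\qquad E_k(T_{\mathcal M}\,\overline s,\overline w)\le P_{ak+b}(\mathcal M,s,w).$$ -/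

import Mathlib

open scoped ENNReal

/-! ### Multidistributions and their reduction -/

/-- Finite multisets of weighted elements. All the multidistributions used below are reached from a
point multidistribution by `liftStep`, so their weights are positive and sum up to at most one. -/
abbrev MDist (X : Type) : Type := Multiset (ℝ≥0∞ × X)

/-- The product of a scalar and a multidistribution. -/
noncomputable def MDist.scale {X : Type} (p : ℝ≥0∞) (m : MDist X) : MDist X :=
  m.map fun x => (p * x.1, x.2)

open Classical in
/-- The total weight of the elements that satisfy `P`. -/
noncomputable def MDist.mass {X : Type} (m : MDist X) (P : X → Prop) : ℝ≥0∞ :=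
  (m.map fun x => if P x.2 then x.1 else 0).sum

/-- Lifting of a one-step reduction (`none`: the element is normal) to multidistributions: every
reducible element is reduced, the normal ones are kept. -/
noncomputable def MDist.liftStep {X : Type} (r : X → Option (MDist X)) (m : MDist X) : MDist X :=
  m.bind fun x =>
    match r x.2 with
    | none => {x}
    | some m' => MDist.scale x.1 m'

/-- The `k`-th multidistribution of the reduction sequence that starts at `x`. -/
noncomputable def MDist.run {X : Type} (r : X → Option (MDist X)) (k : ℕ) (x : X) : MDist X :=
  (MDist.liftStep r)^[k] {(1, x)}

/-! ### The probabilistic call-by-value lambda-calculus -/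

/-- The two syntactic categories. -/
inductive Cat : Type
  | val
  | tm

/-- Values and terms, with de Bruijn indices:
`V ::= x | λx.M` and `M ::= V | V V | M ⊕ M | let x = M in M`. -/
inductive Lam : Cat → Type
  | var : ℕ → Lam .val
  | abs : Lam .tm → Lam .val
  | ret : Lam .val → Lam .tm
  | app : Lam .val → Lam .val → Lam .tm
  | choice : Lam .tm → Lam .tm → Lam .tm
  | letin : Lam .tm → Lam .tm → Lam .tm

namespace Lam

/-- Values. -/
abbrev Value : Type := Lam .val

/-- Terms. -/
abbrev Term : Type := Lam .tm

/-- Extension of a renaming under a binder. -/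
def upRen (ξ : ℕ → ℕ) : ℕ → ℕ
  | 0 => 0
  | n + 1 => ξ n + 1

/-- Renaming of the free variables. -/
def rename : {c : Cat} → (ℕ → ℕ) → Lam c → Lam c
  | _, ξ, var n => var (ξ n)
  | _, ξ, abs M => abs (rename (upRen ξ) M)
  | _, ξ, ret V => ret (rename ξ V)
  | _, ξ, app V W => app (rename ξ V) (rename ξ W)
  | _, ξ, choice M N => choice (rename ξ M) (rename ξ N)
  | _, ξ, letin N M => letin (rename ξ N) (rename (upRen ξ) M)

/-- Shifting all the free variables by one. -/
def shift {c : Cat} (M : Lam c) : Lam c := rename Nat.succ M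

/-- Extension of a substitution under a binder. -/
def upSubst (σ : ℕ → Value) : ℕ → Value
  | 0 => var 0
  | n + 1 => shift (σ n)

/-- Capture-avoiding parallel substitution of values for variables. -/
def subst : {c : Cat} → (ℕ → Value) → Lam c → Lam c
  | _, σ, var n => σ n
  | _, σ, abs M => abs (subst (upSubst σ) M)
  | _, σ, ret V => ret (subst σ V)
  | _, σ, app V W => app (subst σ V) (subst σ W)
  | _, σ, choice M N => choice (subst σ M) (subst σ N)
  | _, σ, letin N M => letin (subst σ N) (subst (upSubst σ) M)

/-- The substitution of `V` for the variable `0`; the other variables move down by one. -/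
def single (V : Value) : ℕ → Value
  | 0 => V
  | n + 1 => var n

/-- The contractum `M{V/x}`, where `x` is the variable with index `0` in `M`. -/
def inst (M : Term) (V : Value) : Term := subst (single V) M

/-- All the free variables have an index below `n`. -/
def ClosedAt : {c : Cat} → ℕ → Lam c → Prop
  | _, n, var i => i < n
  | _, n, abs M => ClosedAt (n + 1) M
  | _, n, ret V => ClosedAt n V
  | _, n, app V W => ClosedAt n V ∧ ClosedAt n W
  | _, n, choice M N => ClosedAt n M ∧ ClosedAt n N
  | _, n, letin N M => ClosedAt n N ∧ ClosedAt (n + 1) M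

/-- No free variables. -/
def Closed {c : Cat} (M : Lam c) : Prop := ClosedAt 0 M

/-- One-step reduction to multidistributions; `none` means normal (all values are normal).
The rules: `(λx.M)V → ⟨M{V/x}⟩`, `let x = V in M → ⟨M{V/x}⟩`, `M ⊕ N → ⟨½ M, ½ N⟩`, and
`let x = N in M → ⟨pᵢ (let x = Nᵢ in M)⟩` whenever `N → ⟨pᵢ Nᵢ⟩`. -/
noncomputable def step : {c : Cat} → Lam c → Option (MDist (Lam c))
  | _, var _ => none
  | _, abs _ => none
  | _, ret _ => none
  | _, app (abs M) V => some {(1, inst M V)}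
  | _, app (var _) _ => none
  | _, choice M N => some {(2⁻¹, M), (2⁻¹, N)}
  | _, letin (ret V) M => some {(1, inst M V)}
  | _, letin N M => (step N).map fun m => m.map fun x => (x.1, letin x.2 M)

/-- The probability that `M` evaluates to the value `V` in at most `k` steps. -/
noncomputable def evalWithin (M : Term) (V : Value) (k : ℕ) : ℝ≥0∞ :=
  (MDist.run step k M).mass fun N => N = ret V

/-- The subdistribution on values produced by the evaluation of `M`. -/
noncomputable def evalDist (M : Term) (V : Value) : ℝ≥0∞ := ⨆ k, evalWithin M V k

/-- The application `M V` of a term to a value, i.e. `let x = M in x V` with `x` fresh. -/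
def capp (M : Term) (V : Value) : Term := letin M (app (var 0) (shift V))

/-- The fragment `V ::= x | λx.M`, `M ::= V | M V | M ⊕ M`. -/
inductive IsCPS : {c : Cat} → Lam c → Prop
  | var (n : ℕ) : IsCPS (var n)
  | abs {M : Term} : IsCPS M → IsCPS (abs M)
  | ret {V : Value} : IsCPS V → IsCPS (ret V)
  | capp {M : Term} {V : Value} : IsCPS M → IsCPS V → IsCPS (capp M V)
  | choice {M N : Term} : IsCPS M → IsCPS N → IsCPS (choice M N)

/-- Gödel numbers of values and of terms. -/
def code : {c : Cat} → Lam c → ℕ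
  | _, var n => Nat.pair 0 n
  | _, abs M => Nat.pair 1 (code M)
  | _, ret V => Nat.pair 2 (code V)
  | _, app V W => Nat.pair 3 (Nat.pair (code V) (code W))
  | _, choice M N => Nat.pair 4 (Nat.pair (code M) (code N))
  | _, letin N M => Nat.pair 5 (Nat.pair (code N) (code M))

/-- `λx₁.⋯λxₙ.M` -/
def abss : ℕ → Term → Term
  | 0, M => M
  | n + 1, M => ret (abs (abss n M))

/-- Scott encoding of the strings over the alphabet `{a₁, …, aₘ}`: the empty string is
`λx₁.⋯λxₘ.λy.y`, and `aᵢ·s` is `λx₁.⋯λxₘ.λy.xᵢ s̄`. Inside the `m + 1` binders `y` has index `0`,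
and `xᵢ₊₁`, which belongs to the symbol `i : Fin m`, has index `m - i`. -/
def encString {m : ℕ} : List (Fin m) → Value
  | [] => abs (abss m (ret (var 0)))
  | i :: s => abs (abss m (capp (ret (var (m - i))) (encString s)))

end Lam

/-! ### Probabilistic Turing machines -/

/-- Head moves. -/
inductive Dir : Type
  | left
  | stay
  | right

/-- The number of a head move. -/
def Dir.code : Dir → ℕ
  | .left => 0
  | .stay => 1
  | .right => 2

/-- A probabilistic one-tape Turing machine with tape alphabet `Fin m` and set of states `Fin q`.
`δ` gives two equiprobable transitions (next state, written symbol, head move), or `none`, in which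
case the machine halts. -/
structure PTM : Type where
  m : ℕ
  q : ℕ
  blank : Fin m
  start : Fin q
  δ : Fin q → Fin m → Option ((Fin q × Fin m × Dir) × (Fin q × Fin m × Dir))

/-- Configurations: the state, the cells to the left of the head (the nearest one first), the
scanned symbol, and the cells to the right of the head (the nearest one first). The cells that are
listed are those of the input and those visited so far, all the others are blank. -/
structure PTM.Config (𝓜 : PTM) : Type where
  state : Fin 𝓜.q
  left : List (Fin 𝓜.m)
  head : Fin 𝓜.m
  right : List (Fin 𝓜.m)

namespace PTM

/-- The code of a transition. -/
def transCode {q m : ℕ} (t : Fin q × Fin m × Dir) : ℕ × ℕ × ℕ := (t.1, t.2.1, t.2.2.code)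

/-- The type of the codes of machines. -/
abbrev Code : Type := ℕ × ℕ × ℕ × ℕ × List (List (Option ((ℕ × ℕ × ℕ) × (ℕ × ℕ × ℕ))))

/-- The code of a machine: the numbers of symbols and of states, the blank, the initial state and
the table of the transition function, one row for each state. -/
def code (𝓜 : PTM) : Code :=
  (𝓜.m, 𝓜.q, 𝓜.blank, 𝓜.start,
    List.ofFn fun i => List.ofFn fun a =>
      (𝓜.δ i a).map fun t => (transCode t.1, transCode t.2))

/-- The initial configuration: the head is on the first symbol of the input. -/
def initial (𝓜 : PTM) : List (Fin 𝓜.m) → Config 𝓜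
  | [] => ⟨𝓜.start, [], 𝓜.blank, []⟩
  | a :: s => ⟨𝓜.start, [], a, s⟩

/-- The effect of a transition on a configuration. -/
def move {𝓜 : PTM} (c : Config 𝓜) : Fin 𝓜.q × Fin 𝓜.m × Dir → Config 𝓜
  | (p, b, .left) =>
    match c.left with
    | [] => ⟨p, [], 𝓜.blank, b :: c.right⟩
    | x :: l => ⟨p, l, x, b :: c.right⟩
  | (p, b, .stay) => ⟨p, c.left, b, c.right⟩
  | (p, b, .right) =>
    match c.right with
    | [] => ⟨p, b :: c.left, 𝓜.blank, []⟩
    | x :: r => ⟨p, b :: c.left, x, r⟩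

/-- One computation step; `none` means that the configuration is final. -/
noncomputable def step {𝓜 : PTM} (c : Config 𝓜) : Option (MDist (Config 𝓜)) :=
  (𝓜.δ c.state c.head).map fun t => {(2⁻¹, move c t.1), (2⁻¹, move c t.2)}

/-- The tape content of a configuration. -/
def tape {𝓜 : PTM} (c : Config 𝓜) : List (Fin 𝓜.m) := c.left.reverse ++ c.head :: c.right

/-- The probability that `𝓜` on input `s` halts with output `w` after at most `k` steps. -/
noncomputable def outputWithin (𝓜 : PTM) (s w : List (Fin 𝓜.m)) (k : ℕ) : ℝ≥0∞ :=
  (MDist.run step k (initial 𝓜 s)).mass fun c => 𝓜.δ c.state c.head = none ∧ tape c = w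

/-- The subdistribution on strings produced by the computation of `𝓜` on input `s`. -/
noncomputable def outputDist (𝓜 : PTM) (s w : List (Fin 𝓜.m)) : ℝ≥0∞ := ⨆ k, outputWithin 𝓜 s w k

end PTM

/-! ### Masses along reduction sequences -/

namespace MDist

variable {X : Type} {r : X → Option (MDist X)} {P : X → Prop}

/-! The term runs the machine directly. A configuration becomes `jump d st l r`: a table `d` of
behaviours applied to a state selector, to itself, and to two Scott-encoded strings, the reversed
left part of the tape and the right part with the scanned symbol in front. The table is passed along
as an argument, so self-application provides recursion. A Scott-encoded string is its own case
analysis: applied to one handler per symbol and a default, it selects the handler of its first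
symbol and gives it the tail. Every argument is already a value, which keeps all terms in the CPS
fragment.

One machine step is thus a bounded number of deterministic reductions, exactly one choice, and again
a bounded number of deterministic reductions (`Represents.red_of_step`). In a final configuration
the left string is reversed onto the right one (`Represents.red_of_final`). This takes time linear
in the left string, which gains at most one cell per step, so the cost is charged to the steps
already made.

Both probabilities obey the same first-step equation (`MDist.mass_run_succ`), so induction on the
number of steps compares them. Deterministic reductions only delay the term, whence
`Represents.evalWithin_le` with the same `k`; counting them gives `Represents.haltWithin_le` with a
linear bound. Equality of the distributions follows by taking suprema, since string encoding is
injective and the sum has at most one summand.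

For effectiveness, the same construction is made for arbitrary codes, and its Gödel number is
primitive recursive in the code. The abstractions it uses are closed, so de Bruijn shifts of
arguments can be written down explicitly. -/

theorem mass_add (m n : MDist X) (P : X → Prop) : (m + n).mass P = m.mass P + n.mass P := by
  simp [mass]

theorem mass_scale (p : ℝ≥0∞) (m : MDist X) (P : X → Prop) :
    (scale p m).mass P = p * m.mass P := by
  classical
  simp only [mass, scale, Multiset.map_map, Function.comp_def]
  rw [← Multiset.sum_map_mul_left]
  simp [mul_ite]

theorem liftStep_add (m n : MDist X) : liftStep r (m + n) = liftStep r m + liftStep r n := by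
  simp [liftStep]

theorem liftStep_scale (p : ℝ≥0∞) (m : MDist X) :
    liftStep r (scale p m) = scale p (liftStep r m) := by
  induction m using Multiset.induction with
  | empty => simp [liftStep, scale]
  | cons a m ih =>
    rw [← Multiset.singleton_add, liftStep_add]
    have hadd (m n : MDist X) : scale p (m + n) = scale p m + scale p n := by simp [scale]
    rw [hadd, hadd, liftStep_add, ih]
    congr 1
    cases h : r a.2 <;> simp [liftStep, scale, h, mul_assoc]

/-- Lifted reduction is additive and homogeneous, so a run from a multidistribution is the weighted
superposition of the runs from its elements. -/
theorem mass_iterate_liftStep (k : ℕ) (m : MDist X) (P : X → Prop) :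
    ((liftStep r)^[k] m).mass P = (m.map fun x => x.1 * (run r k x.2).mass P).sum := by
  have hadd (m n : MDist X) :
      (liftStep r)^[k] (m + n) = (liftStep r)^[k] m + (liftStep r)^[k] n := by
    induction k generalizing m n with
    | zero => rfl
    | succ k ih => simp only [Function.iterate_succ_apply, liftStep_add, ih]
  have hscale (p : ℝ≥0∞) (m : MDist X) :
      (liftStep r)^[k] (scale p m) = scale p ((liftStep r)^[k] m) := by
    clear hadd
    induction k generalizing m with
    | zero => rfl
    | succ k ih => simp only [Function.iterate_succ_apply, liftStep_scale, ih]
  induction m using Multiset.induction with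
  | empty =>
    have : (liftStep r)^[k] (0 : MDist X) = 0 := by
      clear hadd hscale
      induction k with
      | zero => rfl
      | succ k ih => simpa [Function.iterate_succ_apply, liftStep] using ih
    simp [this, mass]
  | cons a m ih =>
    rw [← Multiset.singleton_add, hadd, mass_add, ih, Multiset.map_add, Multiset.sum_add]
    congr 1
    have : ({a} : MDist X) = scale a.1 {(1, a.2)} := by simp [scale]
    rw [this, hscale, mass_scale]
    simp [run, scale]

theorem mass_run_zero (x : X) [Decidable (P x)] :
    (run r 0 x).mass P = if P x then 1 else 0 := by
  simp [run, mass]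

theorem mass_run_of_normal {x : X} [Decidable (P x)] (hx : r x = none) (k : ℕ) :
    (run r k x).mass P = if P x then 1 else 0 := by
  have : liftStep r {(1, x)} = {(1, x)} := by simp [liftStep, hx]
  rw [run, Function.iterate_fixed this]
  simp [mass]

/-- First-step analysis: the recursion that is applied both to terms and to machine configurations.
-/
theorem mass_run_succ {x : X} {m : MDist X} (hx : r x = some m) (k : ℕ) (P : X → Prop) :
    (run r (k + 1) x).mass P = (m.map fun y => y.1 * (run r k y.2).mass P).sum := by
  have : liftStep r {(1, x)} = m := by simp [liftStep, hx, scale]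
  rw [run, Function.iterate_succ_apply, this, mass_iterate_liftStep]

/-- Since elements satisfying `P` are normal, weight that has reached `P` stays there. -/
theorem mass_run_mono (hP : ∀ x, P x → r x = none) (x : X) :
    Monotone fun k => (run r k x).mass P := by
  classical
  refine monotone_nat_of_le_succ fun k => ?_
  induction k generalizing x with
  | zero =>
    by_cases h : P x
    · rw [mass_run_of_normal (hP x h), mass_run_of_normal (hP x h)]
    · rw [mass_run_zero, if_neg h]
      exact zero_le
  | succ k ih =>
    cases h : r x with
    | none => rw [mass_run_of_normal h, mass_run_of_normal h]
    | some m =>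
      rw [mass_run_succ h, mass_run_succ h]
      exact Multiset.sum_map_le_sum_map _ _ fun y _ => mul_le_mul_right (ih y.2) _

end MDist

/-! ### Substitution -/

namespace Lam

theorem upRen_comp (ξ ζ : ℕ → ℕ) : upRen ξ ∘ upRen ζ = upRen (ξ ∘ ζ) := by
  funext n
  cases n <;> rfl

theorem rename_rename {c : Cat} (M : Lam c) (ξ ζ : ℕ → ℕ) :
    rename ξ (rename ζ M) = rename (ξ ∘ ζ) M := by
  induction M generalizing ξ ζ <;> simp_all [rename, upRen_comp]

theorem rename_id {c : Cat} (M : Lam c) : rename id M = M := by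
  have up : upRen id = id := by
    funext n
    cases n <;> rfl
  induction M <;> simp_all [rename]

theorem upSubst_comp_upRen (σ : ℕ → Value) (ξ : ℕ → ℕ) :
    upSubst σ ∘ upRen ξ = upSubst (σ ∘ ξ) := by
  funext n
  cases n <;> rfl

theorem subst_rename {c : Cat} (M : Lam c) (σ : ℕ → Value) (ξ : ℕ → ℕ) :
    subst σ (rename ξ M) = subst (σ ∘ ξ) M := by
  induction M generalizing σ ξ <;> simp_all [rename, subst, upSubst_comp_upRen]

theorem rename_comp_upSubst (σ : ℕ → Value) (ξ : ℕ → ℕ) :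
    rename (upRen ξ) ∘ upSubst σ = upSubst (rename ξ ∘ σ) := by
  funext n
  cases n with
  | zero => rfl
  | succ n =>
    simp only [Function.comp_apply, upSubst, shift, rename_rename]
    rfl

theorem rename_subst {c : Cat} (M : Lam c) (σ : ℕ → Value) (ξ : ℕ → ℕ) :
    rename ξ (subst σ M) = subst (rename ξ ∘ σ) M := by
  induction M generalizing σ ξ <;> simp_all [rename, subst, rename_comp_upSubst]

theorem subst_upSubst_shift {c : Cat} (M : Lam c) (σ : ℕ → Value) :
    subst (upSubst σ) (shift M) = shift (subst σ M) := by
  rw [shift, subst_rename, shift, rename_subst]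
  rfl

theorem subst_comp_upSubst (σ τ : ℕ → Value) :
    subst (upSubst τ) ∘ upSubst σ = upSubst (subst τ ∘ σ) := by
  funext n
  cases n with
  | zero => rfl
  | succ n => simp only [Function.comp_apply, upSubst, subst_upSubst_shift]

/-- Successive beta steps can thereby be recorded as one parallel substitution, used below as an
environment. -/
theorem subst_subst {c : Cat} (M : Lam c) (σ τ : ℕ → Value) :
    subst τ (subst σ M) = subst (subst τ ∘ σ) M := by
  induction M generalizing σ τ <;> simp_all [subst, subst_comp_upSubst]

theorem subst_var {c : Cat} (M : Lam c) : subst var M = M := by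
  have up : upSubst var = var := by
    funext n
    cases n <;> rfl
  induction M <;> simp_all [subst]

theorem rename_of_closedAt {c : Cat} {n : ℕ} {M : Lam c} (hM : ClosedAt n M) {ξ : ℕ → ℕ}
    (hξ : ∀ i < n, ξ i = i) : rename ξ M = M := by
  have up {n : ℕ} {ξ : ℕ → ℕ} (hξ : ∀ i < n, ξ i = i) : ∀ i < n + 1, upRen ξ i = i := by
    rintro (_ | i) hi
    · rfl
    · simp [upRen, hξ i (by omega)]
  induction M generalizing n ξ with
  | var i => simp [rename, hξ i hM]
  | abs M ih => simp [rename, ih hM (up hξ)]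
  | ret V ih => simp [rename, ih hM hξ]
  | app V W ih₁ ih₂ => simp [rename, ih₁ hM.1 hξ, ih₂ hM.2 hξ]
  | choice V W ih₁ ih₂ => simp [rename, ih₁ hM.1 hξ, ih₂ hM.2 hξ]
  | letin V W ih₁ ih₂ => simp [rename, ih₁ hM.1 hξ, ih₂ hM.2 (up hξ)]

theorem subst_of_closedAt {c : Cat} {n : ℕ} {M : Lam c} (hM : ClosedAt n M) {σ : ℕ → Value}
    (hσ : ∀ i < n, σ i = var i) : subst σ M = M := by
  have up {n : ℕ} {σ : ℕ → Value} (hσ : ∀ i < n, σ i = var i) :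
      ∀ i < n + 1, upSubst σ i = var i := by
    rintro (_ | i) hi
    · rfl
    · simp [upSubst, hσ i (by omega), shift, rename]
  induction M generalizing n σ with
  | var i => exact hσ i hM
  | abs M ih => simp [subst, ih hM (up hσ)]
  | ret V ih => simp [subst, ih hM hσ]
  | app V W ih₁ ih₂ => simp [subst, ih₁ hM.1 hσ, ih₂ hM.2 hσ]
  | choice V W ih₁ ih₂ => simp [subst, ih₁ hM.1 hσ, ih₂ hM.2 hσ]
  | letin V W ih₁ ih₂ => simp [subst, ih₁ hM.1 hσ, ih₂ hM.2 (up hσ)]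

theorem closedAt_rename {c : Cat} {n k : ℕ} {M : Lam c} (hM : ClosedAt n M) {ξ : ℕ → ℕ}
    (hξ : ∀ i < n, ξ i < k) : ClosedAt k (rename ξ M) := by
  have up {n k : ℕ} {ξ : ℕ → ℕ} (hξ : ∀ i < n, ξ i < k) : ∀ i < n + 1, upRen ξ i < k + 1 := by
    rintro (_ | i) hi
    · simp [upRen]
    · simpa [upRen] using hξ i (by omega)
  induction M generalizing n k ξ with
  | var i => exact hξ i hM
  | abs M ih => exact ih (n := n + 1) (k := k + 1) hM (up hξ)
  | ret V ih => exact ih (n := n) hM hξ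
  | app V W ih₁ ih₂ => exact ⟨ih₁ hM.1 hξ, ih₂ hM.2 hξ⟩
  | choice V W ih₁ ih₂ => exact ⟨ih₁ hM.1 hξ, ih₂ hM.2 hξ⟩
  | letin V W ih₁ ih₂ => exact ⟨ih₁ hM.1 hξ, ih₂ hM.2 (up hξ)⟩

theorem ClosedAt.mono {c : Cat} {n k : ℕ} {M : Lam c} (hM : ClosedAt n M) (h : n ≤ k) :
    ClosedAt k M := by
  have := closedAt_rename (k := k) (ξ := id) hM fun i hi => hi.trans_le h
  rwa [rename_of_closedAt hM (ξ := id) fun i _ => rfl] at this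

theorem Closed.subst_eq {c : Cat} {M : Lam c} (hM : Closed M) (σ : ℕ → Value) :
    subst σ M = M :=
  subst_of_closedAt hM fun _ hi => absurd hi (Nat.not_lt_zero _)

theorem Closed.shift_eq {c : Cat} {M : Lam c} (hM : Closed M) : shift M = M :=
  rename_of_closedAt hM fun _ hi => absurd hi (Nat.not_lt_zero _)

theorem Closed.closedAt {c : Cat} {M : Lam c} (hM : Closed M) (n : ℕ) : ClosedAt n M :=
  ClosedAt.mono hM (Nat.zero_le n)

/-! ### Iterated abstractions and applications -/

/-- `λx₀.⋯λxₙ.M` -/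
def lam (n : ℕ) (M : Term) : Value := abs (abss n M)

/-- The application of a term to a list of values. -/
def apps (M : Term) (Vs : List Value) : Term := Vs.foldl capp M

@[simp] theorem apps_nil (M : Term) : apps M [] = M := rfl

@[simp] theorem apps_cons (M : Term) (V : Value) (Vs : List Value) :
    apps M (V :: Vs) = apps (capp M V) Vs := rfl

theorem apps_append (M : Term) (Vs Ws : List Value) :
    apps M (Vs ++ Ws) = apps (apps M Vs) Ws := by
  simp [apps]

theorem subst_capp (σ : ℕ → Value) (M : Term) (V : Value) :
    subst σ (capp M V) = capp (subst σ M) (subst σ V) := by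
  simp [capp, subst, subst_upSubst_shift, upSubst]

theorem subst_apps (σ : ℕ → Value) (M : Term) (Vs : List Value) :
    subst σ (apps M Vs) = apps (subst σ M) (Vs.map (subst σ)) := by
  induction Vs generalizing M with
  | nil => rfl
  | cons V Vs ih => simp [ih, subst_capp]

theorem subst_abss (σ : ℕ → Value) (n : ℕ) (M : Term) :
    subst σ (abss n M) = abss n (subst (upSubst^[n] σ) M) := by
  induction n generalizing σ with
  | zero => rfl
  | succ n ih => simp [abss, subst, ih]

theorem iterate_upSubst_of_lt (σ : ℕ → Value) {n i : ℕ} (h : i < n) :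
    upSubst^[n] σ i = var i := by
  induction n generalizing i with
  | zero => omega
  | succ n ih =>
    rw [Function.iterate_succ_apply']
    cases i with
    | zero => rfl
    | succ i => simp [upSubst, ih (i := i) (by omega), shift, rename]

theorem iterate_upSubst_add (σ : ℕ → Value) (n : ℕ) {i : ℕ} (h : Closed (σ i)) :
    upSubst^[n] σ (i + n) = σ i := by
  induction n with
  | zero => rfl
  | succ n ih =>
    rw [Function.iterate_succ_apply', ← add_assoc]
    simp [upSubst, ih, h.shift_eq]

theorem closedAt_abss {n k : ℕ} {M : Term} : ClosedAt k (abss n M) ↔ ClosedAt (k + n) M := by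
  induction n generalizing k with
  | zero => rfl
  | succ n ih => rw [abss, ClosedAt, ClosedAt, ih, add_right_comm, add_assoc]

theorem closedAt_lam {n k : ℕ} {M : Term} : ClosedAt k (lam n M) ↔ ClosedAt (k + n + 1) M := by
  rw [lam, ClosedAt, closedAt_abss, add_right_comm]

theorem closedAt_capp {n : ℕ} {M : Term} {V : Value} (hM : ClosedAt n M) (hV : ClosedAt n V) :
    ClosedAt n (capp M V) :=
  ⟨hM, Nat.succ_pos n, closedAt_rename hV fun _ hi => Nat.succ_lt_succ hi⟩

theorem closedAt_apps {n : ℕ} {M : Term} {Vs : List Value} (hM : ClosedAt n M)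
    (hVs : ∀ V ∈ Vs, ClosedAt n V) : ClosedAt n (apps M Vs) := by
  induction Vs generalizing M with
  | nil => exact hM
  | cons V Vs ih =>
    exact ih (closedAt_capp hM (hVs V (by simp))) fun W hW => hVs W (by simp [hW])

theorem isCPS_lam {n : ℕ} {M : Term} (hM : IsCPS M) : IsCPS (lam n M) := by
  refine .abs ?_
  induction n with
  | zero => exact hM
  | succ n ih => exact .ret (.abs ih)

theorem isCPS_apps {M : Term} {Vs : List Value} (hM : IsCPS M) (hVs : ∀ V ∈ Vs, IsCPS V) :
    IsCPS (apps M Vs) := by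
  induction Vs generalizing M with
  | nil => exact hM
  | cons V Vs ih => exact ih (.capp hM (hVs V (by simp))) fun W hW => hVs W (by simp [hW])

/-! ### Deterministic reductions -/

/-- `M` reduces to `N` in at most `n` steps that do not involve any choice. -/
inductive Red : ℕ → Term → Term → Prop
  | refl (n : ℕ) (M : Term) : Red n M M
  | head {n : ℕ} {M M' N : Term} : step M = some {(1, M')} → Red n M' N → Red (n + 1) M N

theorem Red.mono {n k : ℕ} {M N : Term} (h : Red n M N) (hn : n ≤ k) : Red k M N := by
  induction h generalizing k with
  | refl n M => exact .refl k M
  | head hs _ ih =>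
    obtain ⟨k, rfl⟩ : ∃ j, k = j + 1 := ⟨k - 1, by omega⟩
    exact .head hs (ih (by omega))

theorem Red.trans {n k : ℕ} {M N K : Term} (h : Red n M N) (h' : Red k N K) :
    Red (n + k) M K := by
  induction h with
  | refl n M => exact h'.mono (by omega)
  | head hs _ ih => exact (Red.head hs (ih h')).mono (by omega)

theorem Red.letin {n : ℕ} {M N : Term} (h : Red n M N) (K : Term) :
    Red n (letin M K) (letin N K) := by
  induction h with
  | refl n M => exact .refl n _
  | @head n M M' N hs _ ih =>
    refine .head ?_ ih
    cases M with
    | ret V => simp [step] at hs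
    | app V W => simp only [step, hs, Option.map_some, Multiset.map_singleton]
    -- A choice steps to two elements, never to a singleton; comparing cardinalities excludes it.
    | choice M N => simpa [step] using congrArg (Option.map Multiset.card) hs
    | letin M N => simp only [step, hs, Option.map_some, Multiset.map_singleton]

theorem Red.apps {n : ℕ} {M N : Term} (h : Red n M N) (Vs : List Value) :
    Red n (apps M Vs) (apps N Vs) := by
  induction Vs generalizing M N with
  | nil => exact h
  | cons V Vs ih => exact ih (h.letin _)

theorem inst_app_shift (V W : Value) : inst (app (var 0) (shift V)) W = app W V := by
  simp only [inst, subst, single, shift, subst_rename]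
  congr 1
  have : single W ∘ Nat.succ = var := by
    funext n
    rfl
  rw [this]
  exact subst_var V

/-- The extension of an environment by one value. -/
def scons (V : Value) (σ : ℕ → Value) : ℕ → Value
  | 0 => V
  | n + 1 => σ n

/-- Contracting a beta-redex under an environment amounts to pushing one value onto the environment.
-/
theorem subst_single_subst {c : Cat} (M : Lam c) (V : Value) (σ : ℕ → Value) :
    subst (single V) (subst (upSubst σ) M) = subst (scons V σ) M := by
  rw [subst_subst]
  congr 1
  funext n
  cases n with
  | zero => rfl
  | succ n =>
    have h := inst_app_shift (σ n) V
    simp only [inst, subst, app.injEq] at h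
    exact h.2

/-- Each argument costs two steps: the `let` hidden in `capp` binds the abstraction, then the
resulting redex is contracted. All later constants are built from this factor. -/
theorem red_beta (σ : ℕ → Value) (M : Term) (V : Value) :
    Red 2 (capp (subst σ (ret (abs M))) V) (subst (scons V σ) M) := by
  refine .head (M' := app (subst σ (abs M)) V) ?_ (.head (M' := subst (scons V σ) M) ?_ (.refl _ _))
  · simp [capp, subst, step, inst_app_shift]
  · simp [subst, step, inst, subst_single_subst]

/-- The extension of an environment by a list of values, the last of which gets the index `0`. -/
def extend (σ : ℕ → Value) (Vs : List Value) : ℕ → Value := Vs.foldl (fun σ V => scons V σ) σ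

theorem extend_length_sub (σ : ℕ → Value) (Vs : List Value) (i : ℕ) (hi : i < Vs.length) :
    extend σ Vs (Vs.length - 1 - i) = Vs[i] := by
  -- Indices beyond the list read the old environment; in the induction this locates the first
  -- value, which was pushed earliest.
  have hle (Vs : List Value) (σ : ℕ → Value) (i : ℕ) :
      extend σ Vs (Vs.length + i) = σ i := by
    induction Vs generalizing σ i with
    | nil => simp [extend]
    | cons V Vs ih =>
      have := ih (scons V σ) (i + 1)
      simp only [extend, List.foldl_cons, List.length_cons] at this ⊢
      rw [show Vs.length + 1 + i = Vs.length + (i + 1) by omega, this]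
      rfl
  induction Vs generalizing σ i with
  | nil => simp at hi
  | cons V Vs ih =>
    cases i with
    | zero => simpa [extend, scons] using hle Vs (scons V σ) 0
    | succ i =>
      have := ih (scons V σ) i (by simpa using hi)
      simp only [extend, List.foldl_cons, List.length_cons, List.getElem_cons_succ] at this ⊢
      rwa [show Vs.length + 1 - 1 - (i + 1) = Vs.length - 1 - i by omega]

theorem red_apps_abss (σ : ℕ → Value) (M : Term) (Vs : List Value) :
    Red (2 * Vs.length) (apps (subst σ (abss Vs.length M)) Vs) (subst (extend σ Vs) M) := by
  induction Vs generalizing σ with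
  | nil => exact .refl _ _
  | cons V Vs ih =>
    exact (((red_beta σ _ V).apps Vs).trans (ih (scons V σ))).mono (by simp; omega)

/-- The application of a closed abstraction to as many values as it has binders. -/
theorem red_apps_lam {n : ℕ} {M : Term} (h : Closed (lam n M)) {Vs : List Value}
    (hVs : Vs.length = n + 1) :
    Red (2 * (n + 1)) (apps (ret (lam n M)) Vs) (subst (extend var Vs) M) := by
  have := red_apps_abss var M Vs
  rw [hVs] at this
  -- The computation starts from the identity environment, which leaves the abstraction unchanged.
  have h' : subst var (abss (n + 1) M) = ret (lam n M) := by
    change subst var (ret (lam n M)) = _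
    exact Closed.subst_eq (M := ret (lam n M)) h var
  rwa [h'] at this

/-! ### Evaluation probabilities along choices and deterministic reductions -/

theorem evalWithin_mono (M : Term) (V : Value) : Monotone (evalWithin M V) :=
  MDist.mass_run_mono (by rintro _ rfl; rfl) M

theorem evalWithin_succ_of_step {M N : Term} (h : step M = some {(1, N)}) (V : Value) (k : ℕ) :
    evalWithin M V (k + 1) = evalWithin N V k := by
  simp [evalWithin, MDist.mass_run_succ h]

theorem evalWithin_choice_succ (M N : Term) (V : Value) (k : ℕ) :
    evalWithin (choice M N) V (k + 1) = 2⁻¹ * evalWithin M V k + 2⁻¹ * evalWithin N V k := by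
  have h : step (choice M N) = some {(2⁻¹, M), (2⁻¹, N)} := rfl
  simp [evalWithin, MDist.mass_run_succ h]

theorem evalWithin_choice_zero (M N : Term) (V : Value) : evalWithin (choice M N) V 0 = 0 := by
  classical
  simp [evalWithin, MDist.mass_run_zero]

open Classical in
theorem evalWithin_ret (W V : Value) (k : ℕ) :
    evalWithin (ret W) V k = if W = V then 1 else 0 := by
  have h : step (ret W) = none := rfl
  simp [evalWithin, MDist.mass_run_of_normal h]

theorem Red.le_evalWithin {n : ℕ} {M N : Term} (h : Red n M N) (V : Value) (k : ℕ) :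
    evalWithin N V k ≤ evalWithin M V (n + k) := by
  induction h with
  | refl n M => exact evalWithin_mono M V (by omega)
  | head hs _ ih =>
    rw [show ∀ n, n + 1 + k = n + k + 1 by omega, evalWithin_succ_of_step hs]
    exact ih

/-- Deterministic steps only use up the budget, so skipping them cannot lower the probability for
the same `k`. -/
theorem Red.evalWithin_le {n : ℕ} {M N : Term} (h : Red n M N) (V : Value) (k : ℕ) :
    evalWithin M V k ≤ evalWithin N V k := by
  induction h with
  | refl n M => exact le_rfl
  | head hs _ ih =>
    refine (evalWithin_mono _ V k.le_succ).trans ?_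
    rw [evalWithin_succ_of_step hs]
    exact ih

end Lam

namespace Lam

/-! ### The simulating term

All the abstractions below are closed, and they are applied to variables, to closed values, and to
strings `consV m j n` whose tail is a variable. -/

/-- The list `[f 0, …, f (n - 1), V]` of the arguments of an encoded string or state. -/
def branches (n : ℕ) (f : ℕ → Value) (V : Value) : List Value := (List.range n).map f ++ [V]

/-- The encoding of the empty string. -/
def nilV (m : ℕ) : Value := lam m (ret (var 0))

/-- The encoding of the string whose first symbol is `j` and whose tail is the variable `n`. -/
def consV (m j n : ℕ) : Value := lam m (capp (ret (var (m - j))) (var (n + m + 1)))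

/-- The encoding of the state `p`: a projection that also takes a dummy argument. -/
def sel (q p : ℕ) : Value := lam q (ret (var (q - p)))

/-- The configuration with state `st`, left string `l` and right string `r` (the scanned symbol
included), for the table `d`. -/
def jump (d st l r : Value) : Term := apps (ret d) [st, d, l, r]

/-- `λl.λd.λr.` enter the state `p` with `x` under the head. -/
def moveLeftCons (m q p x : ℕ) : Value :=
  lam 2 (jump (var 1) (sel q p) (var 2) (consV m x 0))

/-- `λd.λr.` enter the state `p` with the blank `b` under the head and nothing to the left. -/
def moveLeftNil (m q b p : ℕ) : Value :=
  lam 1 (jump (var 1) (sel q p) (nilV m) (consV m b 0))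

/-- The effect of a transition. The variables `2`, `1`, `0` stand for the string to the right of
the head, for the table, and for the string to the left of the head. -/
def act (m q b : ℕ) (t : ℕ × ℕ × ℕ) : Term :=
  if t.2.2 = 0 then
    apps (ret (var 0)) (branches m (moveLeftCons m q t.1) (moveLeftNil m q b t.1) ++
      [var 1, consV m t.2.1 2])
  else if t.2.2 = 1 then jump (var 1) (sel q t.1) (var 0) (consV m t.2.1 2)
  else jump (var 1) (sel q t.1) (consV m t.2.1 0) (var 2)

/-- `λl.λe.λr. e e l (j·r)` -/
def revCons (m j : ℕ) : Value := lam 2 (apps (ret (var 1)) [var 1, var 2, consV m j 0])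

/-- `λe.λr. r` -/
def revNil : Value := lam 1 (ret (var 0))

/-- The function that prepends the reverse of a string to another string; its first argument is the
function itself. -/
def rev (m : ℕ) : Value :=
  lam 2 (apps (ret (var 1)) (branches m (revCons m) revNil ++ [var 2, var 0]))

/-- The body of the function `λr.λd.λl.` for a state and a scanned symbol `i`. -/
def handlerBody (m q b i : ℕ) : Option ((ℕ × ℕ × ℕ) × (ℕ × ℕ × ℕ)) → Term
  | none => apps (ret (rev m)) [rev m, var 0, consV m i 2]
  | some t => choice (act m q b t.1) (act m q b t.2)

variable (m q b : ℕ) (δ : ℕ → ℕ → Option ((ℕ × ℕ × ℕ) × (ℕ × ℕ × ℕ)))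

/-- The behaviour in the state `p` on the scanned symbol `i`. -/
def handler (p i : ℕ) : Value := lam 2 (handlerBody m q b i (δ p i))

/-- The behaviour in the state `p` when the head has left the listed cells to the right. -/
def blankHandler (p : ℕ) : Value :=
  lam 1 (apps (ret (handler m q b δ p b)) [nilV m, var 1, var 0])

/-- `λd.λl.λr.` the behaviour in the state `p`. -/
def stateV (p : ℕ) : Value :=
  lam 2 (apps (ret (var 0))
    (branches m (handler m q b δ p) (blankHandler m q b δ p) ++ [var 2, var 1]))

/-- The tuple of the behaviours in all the states. -/
def table : Value := lam 0 (apps (ret (var 0)) (branches q (stateV m q b δ) (nilV m)))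

/-- The simulating term, with initial state `p`. -/
def simulator (p : ℕ) : Term :=
  ret (lam 0 (jump (table m q b δ) (sel q p) (nilV m) (var 0)))

/-! ### Closedness -/

theorem forall_mem_branches {P : Value → Prop} {n : ℕ} {f : ℕ → Value} {V : Value}
    (hf : ∀ i, P (f i)) (hV : P V) : ∀ W ∈ branches n f V, P W := by
  intro W hW
  simp only [branches, List.mem_append, List.mem_map, List.mem_singleton] at hW
  rcases hW with ⟨i, -, rfl⟩ | rfl
  exacts [hf i, hV]

theorem closed_nilV : Closed (nilV m) := closedAt_lam.2 (by simp [ClosedAt])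

theorem closedAt_consV (j : ℕ) {k n : ℕ} (h : n < k) : ClosedAt k (consV m j n) :=
  closedAt_lam.2 (closedAt_capp (by simp only [ClosedAt]; omega) (by simp only [ClosedAt]; omega))

theorem closed_sel (p : ℕ) : Closed (sel q p) :=
  closedAt_lam.2 (by simp only [ClosedAt]; omega)

theorem closedAt_jump {k : ℕ} {d st l r : Value} (hd : ClosedAt k d) (hst : ClosedAt k st)
    (hl : ClosedAt k l) (hr : ClosedAt k r) : ClosedAt k (jump d st l r) :=
  closedAt_apps hd (by simp [hd, hst, hl, hr])

theorem closedAt_var {k n : ℕ} (h : n < k) : ClosedAt k (var n) := h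

theorem closed_moveLeftCons (p x : ℕ) : Closed (moveLeftCons m q p x) :=
  closedAt_lam.2 (closedAt_jump (closedAt_var (by omega)) ((closed_sel q p).closedAt _)
    (closedAt_var (by omega)) (closedAt_consV m x (by omega)))

theorem closed_moveLeftNil (p : ℕ) : Closed (moveLeftNil m q b p) :=
  closedAt_lam.2 (closedAt_jump (closedAt_var (by omega)) ((closed_sel q p).closedAt _)
    ((closed_nilV m).closedAt _) (closedAt_consV m b (by omega)))

theorem closedAt_act (t : ℕ × ℕ × ℕ) : ClosedAt 3 (act m q b t) := by
  unfold act
  split_ifs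
  · refine closedAt_apps (closedAt_var (by omega)) fun V hV => ?_
    rcases List.mem_append.1 hV with hV | hV
    · exact (forall_mem_branches (P := Closed) (closed_moveLeftCons m q t.1)
        (closed_moveLeftNil m q b t.1) V hV).closedAt 3
    · simp only [List.mem_cons, List.not_mem_nil, or_false] at hV
      rcases hV with rfl | rfl
      exacts [closedAt_var (by omega), closedAt_consV m _ (by omega)]
  · exact closedAt_jump (closedAt_var (by omega)) ((closed_sel q _).closedAt _)
      (closedAt_var (by omega)) (closedAt_consV m _ (by omega))
  · exact closedAt_jump (closedAt_var (by omega)) ((closed_sel q _).closedAt _)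
      (closedAt_consV m _ (by omega)) (closedAt_var (by omega))

theorem closed_revCons (j : ℕ) : Closed (revCons m j) :=
  closedAt_lam.2 (closedAt_apps (closedAt_var (by omega))
    (by simp [ClosedAt, closedAt_consV]))

theorem closed_revNil : Closed revNil := closedAt_lam.2 (closedAt_var (by omega))

theorem closed_rev : Closed (rev m) := by
  refine closedAt_lam.2 (closedAt_apps (closedAt_var (by omega)) fun V hV => ?_)
  rcases List.mem_append.1 hV with hV | hV
  · exact (forall_mem_branches (P := Closed) (closed_revCons m) closed_revNil V hV).closedAt _
  · simp only [List.mem_cons, List.not_mem_nil, or_false] at hV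
    rcases hV with rfl | rfl <;> exact closedAt_var (by omega)

theorem closed_handler (p i : ℕ) : Closed (handler m q b δ p i) := by
  refine closedAt_lam.2 ?_
  cases δ p i with
  | none =>
    exact closedAt_apps ((closed_rev m).closedAt _)
      (by simp [(closed_rev m).closedAt, ClosedAt, closedAt_consV])
  | some t => exact ⟨closedAt_act m q b t.1, closedAt_act m q b t.2⟩

theorem closed_blankHandler (p : ℕ) : Closed (blankHandler m q b δ p) :=
  closedAt_lam.2 (closedAt_apps ((closed_handler m q b δ p b).closedAt _)
    (by simp [(closed_nilV m).closedAt, ClosedAt]))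

theorem closed_stateV (p : ℕ) : Closed (stateV m q b δ p) := by
  refine closedAt_lam.2 (closedAt_apps (closedAt_var (by omega)) fun V hV => ?_)
  rcases List.mem_append.1 hV with hV | hV
  · exact (forall_mem_branches (P := Closed) (closed_handler m q b δ p)
      (closed_blankHandler m q b δ p) V hV).closedAt _
  · simp only [List.mem_cons, List.not_mem_nil, or_false] at hV
    rcases hV with rfl | rfl <;> exact closedAt_var (by omega)

theorem closed_table : Closed (table m q b δ) :=
  closedAt_lam.2 (closedAt_apps (closedAt_var (by omega)) fun V hV =>
    (forall_mem_branches (P := Closed) (closed_stateV m q b δ) (closed_nilV m) V hV).closedAt _)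

theorem closed_simulator (p : ℕ) : Closed (simulator m q b δ p) :=
  closedAt_lam.2 (closedAt_jump ((closed_table m q b δ).closedAt _) ((closed_sel q p).closedAt _)
    ((closed_nilV m).closedAt _) (closedAt_var (by omega)))

/-! ### Membership in the fragment -/

theorem isCPS_retVar (n : ℕ) : IsCPS (ret (var n)) := .ret (.var n)

theorem isCPS_nilV : IsCPS (nilV m) := isCPS_lam (isCPS_retVar 0)

theorem isCPS_consV (j n : ℕ) : IsCPS (consV m j n) :=
  isCPS_lam (.capp (isCPS_retVar _) (.var _))

theorem isCPS_sel (p : ℕ) : IsCPS (sel q p) := isCPS_lam (isCPS_retVar _)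

theorem isCPS_jump {d st l r : Value} (hd : IsCPS d) (hst : IsCPS st) (hl : IsCPS l)
    (hr : IsCPS r) : IsCPS (jump d st l r) :=
  isCPS_apps (.ret hd) (by simp [hd, hst, hl, hr])

theorem isCPS_apps_branches {M : Term} {n : ℕ} {f : ℕ → Value} {V : Value} {Vs : List Value}
    (hM : IsCPS M) (hf : ∀ i, IsCPS (f i)) (hV : IsCPS V) (hVs : ∀ W ∈ Vs, IsCPS W) :
    IsCPS (apps M (branches n f V ++ Vs)) :=
  isCPS_apps hM fun W hW => (List.mem_append.1 hW).elim (forall_mem_branches hf hV W) (hVs W)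

theorem isCPS_act (t : ℕ × ℕ × ℕ) : IsCPS (act m q b t) := by
  unfold act
  split_ifs
  · exact isCPS_apps_branches (isCPS_retVar 0)
      (fun x => isCPS_lam (isCPS_jump (.var 1) (isCPS_sel q _) (.var 2) (isCPS_consV m x 0)))
      (isCPS_lam (isCPS_jump (.var 1) (isCPS_sel q _) (isCPS_nilV m) (isCPS_consV m b 0)))
      (by simp [IsCPS.var, isCPS_consV])
  · exact isCPS_jump (.var 1) (isCPS_sel q _) (.var 0) (isCPS_consV m _ 2)
  · exact isCPS_jump (.var 1) (isCPS_sel q _) (isCPS_consV m _ 0) (.var 2)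

theorem isCPS_rev : IsCPS (rev m) :=
  isCPS_lam (isCPS_apps_branches (isCPS_retVar 1)
    (fun j => isCPS_lam (isCPS_apps (isCPS_retVar 1) (by simp [IsCPS.var, isCPS_consV])))
    (isCPS_lam (isCPS_retVar 0)) (by simp [IsCPS.var]))

theorem isCPS_handler (p i : ℕ) : IsCPS (handler m q b δ p i) := by
  refine isCPS_lam ?_
  cases δ p i with
  | none => exact isCPS_apps (.ret (isCPS_rev m)) (by simp [IsCPS.var, isCPS_rev, isCPS_consV])
  | some t => exact .choice (isCPS_act m q b t.1) (isCPS_act m q b t.2)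

theorem isCPS_stateV (p : ℕ) : IsCPS (stateV m q b δ p) :=
  isCPS_lam (isCPS_apps_branches (isCPS_retVar 0) (isCPS_handler m q b δ p)
    (isCPS_lam (isCPS_apps (.ret (isCPS_handler m q b δ p b)) (by simp [IsCPS.var, isCPS_nilV])))
    (by simp [IsCPS.var]))

theorem isCPS_table : IsCPS (table m q b δ) :=
  isCPS_lam (isCPS_apps (isCPS_retVar 0)
    (forall_mem_branches (isCPS_stateV m q b δ) (isCPS_nilV m)))

theorem isCPS_simulator (p : ℕ) : IsCPS (simulator m q b δ p) :=
  .ret (isCPS_lam (isCPS_jump (isCPS_table m q b δ) (isCPS_sel q p) (isCPS_nilV m) (.var 0)))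

/-! ### Encoded strings -/

variable {m q}

theorem closed_encString (s : List (Fin m)) : Closed (encString s) := by
  induction s with
  | nil => exact closed_nilV m
  | cons i s ih =>
    exact closedAt_lam.2 (closedAt_capp (closedAt_var (by omega)) (ih.closedAt _))

/-- Renaming by the predecessor is a left inverse of the shift. -/
theorem shift_injective {c : Cat} : Function.Injective (shift : Lam c → Lam c) := by
  intro M N h
  have hid (K : Lam c) : rename Nat.pred (shift K) = K := by
    rw [shift, rename_rename]
    have : Nat.pred ∘ Nat.succ = id := rfl
    rw [this]
    exact rename_id K
  rw [← hid M, h, hid]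

theorem abss_injective (n : ℕ) : Function.Injective (abss n) := by
  induction n with
  | zero => exact fun _ _ h => h
  | succ n ih =>
    intro M N h
    simp only [abss, ret.injEq, abs.injEq] at h
    exact ih h

theorem lam_injective (n : ℕ) : Function.Injective (lam n) := fun _ _ h =>
  abss_injective n (abs.inj h)

theorem encString_injective : Function.Injective (encString : List (Fin m) → Value) := by
  intro s t h
  induction s generalizing t with
  | nil =>
    cases t with
    | nil => rfl
    | cons j t => exact absurd (lam_injective m h) (by simp [capp])
  | cons i s ih =>
    cases t with
    | nil => exact absurd (lam_injective m h) (by simp [capp])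
    | cons j t =>
      have h' := lam_injective m h
      simp only [capp, letin.injEq, ret.injEq, var.injEq, app.injEq, true_and] at h'
      rw [ih (shift_injective h'.2), Fin.ext (a := i) (b := j) (by omega)]

theorem length_branches (n : ℕ) (f : ℕ → Value) (V : Value) :
    (branches n f V).length = n + 1 := by simp [branches]

theorem extend_branches {n i : ℕ} (hi : i < n) (f : ℕ → Value) (V : Value) :
    extend var (branches n f V) (n - i) = f i := by
  have := extend_length_sub var (branches n f V) i (by rw [length_branches]; omega)
  rw [show (branches n f V).length - 1 - i = n - i by rw [length_branches]; omega] at this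
  simpa [branches, List.getElem_append, hi] using this

theorem extend_branches_zero (n : ℕ) (f : ℕ → Value) (V : Value) :
    extend var (branches n f V) 0 = V := by
  have := extend_length_sub var (branches n f V) n (by rw [length_branches]; omega)
  rw [show (branches n f V).length - 1 - n = 0 by rw [length_branches]; omega] at this
  simpa [branches, List.getElem_append] using this

theorem map_subst_branches (σ : ℕ → Value) (n : ℕ) {f : ℕ → Value} {V : Value}
    (hf : ∀ i, Closed (f i)) (hV : Closed V) :
    (branches n f V).map (subst σ) = branches n f V := by
  simp [branches, hV.subst_eq, (hf _).subst_eq]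

/-- Filling in a closed tail yields the encoding itself, syntactically: the selector index is below
the `m + 1` binders and stays fixed, while the tail index points just past them. No reduction is
spent on building strings. -/
theorem subst_consV (σ : ℕ → Value) (i : Fin m) (s : List (Fin m)) {n : ℕ}
    (h : σ n = encString s) : subst σ (consV m i n) = encString (i :: s) := by
  have hc : Closed (σ n) := h ▸ closed_encString s
  rw [consV, lam, subst, subst_abss, ← Function.iterate_succ_apply, subst_capp, subst, subst,
    subst, iterate_upSubst_of_lt _ (by omega), add_assoc, iterate_upSubst_add _ _ hc, h]
  rfl

theorem red_encString_nil (f : ℕ → Value) (V : Value) (Vs : List Value) :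
    Red (2 * (m + 1)) (apps (ret (encString ([] : List (Fin m)))) (branches m f V ++ Vs))
      (apps (ret V) Vs) := by
  rw [apps_append]
  have := red_apps_lam (closed_nilV m) (length_branches m f V)
  rw [subst, subst, extend_branches_zero] at this
  exact this.apps Vs

theorem red_encString_cons (i : Fin m) (s : List (Fin m)) (f : ℕ → Value) (V : Value)
    (Vs : List Value) :
    Red (2 * (m + 1)) (apps (ret (encString (i :: s))) (branches m f V ++ Vs))
      (apps (ret (f i)) (encString s :: Vs)) := by
  rw [apps_append]
  have := red_apps_lam (closed_encString (i :: s)) (length_branches m f V)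
  rw [subst_capp, subst, subst, extend_branches i.2, (closed_encString s).subst_eq] at this
  exact this.apps Vs

theorem red_sel {p : ℕ} (hp : p < q) (f : ℕ → Value) (V : Value) :
    Red (2 * (q + 1)) (apps (ret (sel q p)) (branches q f V)) (ret (f p)) := by
  have := red_apps_lam (closed_sel q p) (length_branches q f V)
  rwa [subst, subst, extend_branches hp] at this

/-! ### Reductions of the components of the simulating term -/

theorem subst_ret (σ : ℕ → Value) (V : Value) : subst σ (ret V) = ret (subst σ V) := rfl

theorem red_rev (l r : List (Fin m)) :
    Red ((2 * m + 14) * l.length + (2 * m + 12))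
      (apps (ret (rev m)) [rev m, encString l, encString r]) (ret (encString (l.reverse ++ r))) := by
  have h₁ (l r : List (Fin m)) :
      Red 6 (apps (ret (rev m)) [rev m, encString l, encString r])
        (apps (ret (encString l)) (branches m (revCons m) revNil ++ [rev m, encString r])) := by
    have := red_apps_lam (closed_rev m) (Vs := [rev m, encString l, encString r]) rfl
    rw [subst_apps, List.map_append, map_subst_branches _ _ (closed_revCons m) closed_revNil] at this
    exact this
  induction l generalizing r with
  | nil =>
    refine (((h₁ [] r).trans (red_encString_nil _ _ _)).trans
      (red_apps_lam closed_revNil rfl)).mono ?_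
    simp only [List.length_nil]
    omega
  | cons i l ih =>
    have h₂ := red_apps_lam (closed_revCons m i) (Vs := [encString l, rev m, encString r]) rfl
    rw [subst_apps, List.map_cons, List.map_cons, List.map_cons, subst_consV _ i r rfl] at h₂
    rw [List.reverse_cons, List.append_assoc]
    -- Per symbol: 6 steps to enter `rev`, `2 * (m + 1)` for the case analysis, and 6 for `revCons`.
    refine ((((h₁ _ r).trans (red_encString_cons i l _ _ _)).trans h₂).trans (ih (i :: r))).mono ?_
    simp only [List.length_cons]
    ring_nf
    omega

/-- The cost is 2 for opening the table, `2 * (q + 1)` for the selector, and 6 for the three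
arguments of the state. -/
theorem red_jump {p : ℕ} (hp : p < q) (l r : List (Fin m)) :
    Red (2 * q + 10) (jump (table m q b δ) (sel q p) (encString l) (encString r))
      (apps (ret (encString r)) (branches m (handler m q b δ p) (blankHandler m q b δ p) ++
        [table m q b δ, encString l])) := by
  have h₁ := red_apps_lam (closed_table m q b δ) (Vs := [sel q p]) rfl
  rw [subst_apps, map_subst_branches _ _ (closed_stateV m q b δ) (closed_nilV m)] at h₁
  have h₂ := h₁.trans (red_sel hp (stateV m q b δ) (nilV m))
  have h₃ := red_apps_lam (closed_stateV m q b δ p)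
    (Vs := [table m q b δ, encString l, encString r]) rfl
  rw [subst_apps, List.map_append,
    map_subst_branches _ _ (closed_handler m q b δ p) (closed_blankHandler m q b δ p)] at h₃
  exact ((h₂.apps [table m q b δ, encString l, encString r]).trans h₃).mono (by omega)

/-- The environment of the body of a handler. -/
abbrev handlerEnv (l r : List (Fin m)) : ℕ → Value :=
  extend var [encString r, table m q b δ, encString l]

theorem red_jump_cons {p : ℕ} (hp : p < q) (l : List (Fin m)) (i : Fin m) (r : List (Fin m)) :
    Red (2 * q + 2 * m + 18)
      (jump (table m q b δ) (sel q p) (encString l) (encString (i :: r)))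
      (subst (handlerEnv (q := q) b δ l r) (handlerBody m q b i (δ p i))) :=
  (((red_jump b δ hp l (i :: r)).trans (red_encString_cons i r _ _ _)).trans
    (red_apps_lam (closed_handler m q b δ p i) rfl)).mono (by omega)

/-- An exhausted right string acts as a scanned blank followed by an empty tail; the detour through
`blankHandler` costs 4 more steps than the nonempty case. -/
theorem red_jump_nil {p : ℕ} (hp : p < q) (l : List (Fin m)) :
    Red (2 * q + 2 * m + 22)
      (jump (table m q b δ) (sel q p) (encString l) (encString ([] : List (Fin m))))
      (subst (handlerEnv (q := q) b δ l []) (handlerBody m q b b (δ p b))) := by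
  have h₁ := red_apps_lam (closed_blankHandler m q b δ p)
    (Vs := [table m q b δ, encString l]) rfl
  rw [subst_apps, List.map_cons, (closed_nilV m).subst_eq, subst,
    (closed_handler m q b δ p b).subst_eq] at h₁
  exact ((((red_jump b δ hp l []).trans (red_encString_nil _ _ _)).trans h₁).trans
    (red_apps_lam (closed_handler m q b δ p b) rfl)).mono (by omega)

theorem subst_jump (σ : ℕ → Value) (d st l r : Value) :
    subst σ (jump d st l r) = jump (subst σ d) (subst σ st) (subst σ l) (subst σ r) := by
  rw [jump, subst_apps, subst]
  rfl

theorem red_act_left_cons (p : ℕ) (j x : Fin m) (l r : List (Fin m)) :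
    Red (2 * m + 8) (subst (handlerEnv (q := q) b δ (x :: l) r) (act m q b (p, j, 0)))
      (jump (table m q b δ) (sel q p) (encString l) (encString (x :: j :: r))) := by
  rw [act, if_pos rfl, subst_apps, List.map_append,
    map_subst_branches _ _ (closed_moveLeftCons m q p) (closed_moveLeftNil m q b p),
    List.map_cons, List.map_cons, subst_consV _ j r rfl]
  have h := red_apps_lam (closed_moveLeftCons m q p x)
    (Vs := [encString l, table m q b δ, encString (j :: r)]) rfl
  rw [subst_jump, (closed_sel q p).subst_eq, subst_consV _ x (j :: r) rfl] at h
  exact ((red_encString_cons x l _ _ _).trans h).mono (by omega)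

theorem red_act_left_nil (p : ℕ) (j : Fin m) (c : Fin m) (r : List (Fin m)) :
    Red (2 * m + 8) (subst (handlerEnv (q := q) c δ [] r) (act m q c (p, j, 0)))
      (jump (table m q c δ) (sel q p) (encString ([] : List (Fin m)))
        (encString (c :: j :: r))) := by
  rw [act, if_pos rfl, subst_apps, List.map_append,
    map_subst_branches _ _ (closed_moveLeftCons m q p) (closed_moveLeftNil m q c p),
    List.map_cons, List.map_cons, subst_consV _ j r rfl]
  have h := red_apps_lam (closed_moveLeftNil m q c p)
    (Vs := [table m q c δ, encString (j :: r)]) rfl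
  rw [subst_jump, (closed_sel q p).subst_eq, (closed_nilV m).subst_eq,
    subst_consV _ c (j :: r) rfl] at h
  exact ((red_encString_nil _ _ _).trans h).mono (by omega)

theorem subst_act_stay (p : ℕ) (j : Fin m) (l r : List (Fin m)) :
    subst (handlerEnv (q := q) b δ l r) (act m q b (p, j, 1)) =
      jump (table m q b δ) (sel q p) (encString l) (encString (j :: r)) := by
  rw [act, if_neg one_ne_zero, if_pos rfl, subst_jump, (closed_sel q p).subst_eq,
    subst_consV _ j r rfl]
  rfl

theorem subst_act_right (p : ℕ) (j : Fin m) (l r : List (Fin m)) :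
    subst (handlerEnv (q := q) b δ l r) (act m q b (p, j, 2)) =
      jump (table m q b δ) (sel q p) (encString (j :: l)) (encString r) := by
  rw [act, if_neg two_ne_zero, if_neg (by simp), subst_jump, (closed_sel q p).subst_eq,
    subst_consV _ j l rfl]
  rfl

theorem red_simulator (p : ℕ) (s : List (Fin m)) :
    Red 2 (capp (simulator m q b δ p) (encString s))
      (jump (table m q b δ) (sel q p) (encString ([] : List (Fin m))) (encString s)) := by
  have h := red_apps_lam (closed_simulator m q b δ p) (Vs := [encString s]) rfl
  rw [subst_jump, (closed_sel q p).subst_eq, (closed_nilV m).subst_eq,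
    (closed_table m q b δ).subst_eq] at h
  exact h

end Lam

/-! ### The simulation -/

namespace PTM

open Lam

/-- The entry of a table of transitions. -/
def lookup (c : Code) (p i : ℕ) : Option ((ℕ × ℕ × ℕ) × (ℕ × ℕ × ℕ)) :=
  -- Missing entries count as halting, so that the term is defined for every code.
  (c.2.2.2.2.getD p []).getD i none

/-- The simulating term for the code of a machine. -/
def simulator (c : Code) : Term := Lam.simulator c.1 c.2.1 c.2.2.1 (lookup c) c.2.2.2.1

theorem lookup_code (𝓜 : PTM) (p : Fin 𝓜.q) (i : Fin 𝓜.m) :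
    lookup 𝓜.code p i = (𝓜.δ p i).map fun t => (transCode t.1, transCode t.2) := by
  simp [lookup, code]

variable {𝓜 : PTM}

/-- The value of the table of behaviours of a machine. -/
abbrev tableV (𝓜 : PTM) : Value := table 𝓜.m 𝓜.q 𝓜.blank (lookup 𝓜.code)

/-- The term represents the configuration; a blank suffix of length one may be left implicit. -/
def Represents (M : Term) (c : Config 𝓜) : Prop :=
  ∃ r : List (Fin 𝓜.m), M = jump (tableV 𝓜) (sel 𝓜.q c.state) (encString c.left) (encString r) ∧
    (r = c.head :: c.right ∨ r = [] ∧ c.head = 𝓜.blank ∧ c.right = [])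

theorem represents_initial (s : List (Fin 𝓜.m)) :
    Represents (jump (tableV 𝓜) (sel 𝓜.q 𝓜.start) (encString ([] : List (Fin 𝓜.m))) (encString s))
      (initial 𝓜 s) := by
  cases s with
  | nil => exact ⟨[], rfl, .inr ⟨rfl, rfl, rfl⟩⟩
  | cons i s => exact ⟨i :: s, rfl, .inl rfl⟩

theorem Represents.red {M : Term} {c : Config 𝓜} (h : Represents M c) :
    Red (2 * 𝓜.q + 2 * 𝓜.m + 22) M
      (subst (handlerEnv (q := 𝓜.q) 𝓜.blank (lookup 𝓜.code) c.left c.right)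
        (handlerBody 𝓜.m 𝓜.q 𝓜.blank c.head (lookup 𝓜.code c.state c.head))) := by
  obtain ⟨r, rfl, rfl | ⟨rfl, hb, hr⟩⟩ := h
  · exact (red_jump_cons _ _ c.state.2 _ _ _).mono (by omega)
  · rw [hb, hr]
    exact red_jump_nil _ _ c.state.2 _

theorem Represents.red_of_final {M : Term} {c : Config 𝓜} (h : Represents M c)
    (hc : 𝓜.δ c.state c.head = none) :
    Red ((2 * 𝓜.m + 14) * c.left.length + (2 * 𝓜.q + 4 * 𝓜.m + 34)) M (ret (encString (tape c))) := by
  have h₁ := h.red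
  rw [lookup_code, hc, Option.map_none, handlerBody, subst_apps, List.map_cons, List.map_cons,
    List.map_cons, (closed_rev _).subst_eq, subst_consV _ c.head c.right rfl, subst_ret,
    (closed_rev _).subst_eq] at h₁
  exact (h₁.trans (red_rev c.left (c.head :: c.right))).mono (by omega)

theorem red_act (c : Config 𝓜) (t : Fin 𝓜.q × Fin 𝓜.m × Dir) :
    ∃ M, Red (2 * 𝓜.m + 8)
      (subst (handlerEnv (q := 𝓜.q) 𝓜.blank (lookup 𝓜.code) c.left c.right)
        (act 𝓜.m 𝓜.q 𝓜.blank (transCode t))) M ∧ Represents M (move c t) := by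
  obtain ⟨st, l, x, r⟩ := c
  obtain ⟨p, j, _ | _ | _⟩ := t
  · cases l with
    | nil => exact ⟨_, red_act_left_nil _ p j 𝓜.blank r, _, rfl, .inl rfl⟩
    | cons y l => exact ⟨_, red_act_left_cons _ _ p j y l r, _, rfl, .inl rfl⟩
  · exact ⟨_, .refl _ _, _, subst_act_stay _ _ p j l r, .inl rfl⟩
  · cases r with
    -- Moving right past the listed cells leaves an empty right string: the blank stays implicit
    -- until it is read. The move to the left writes its blank explicitly.
    | nil => exact ⟨_, .refl _ _, _, subst_act_right _ _ p j l [], .inr ⟨rfl, rfl, rfl⟩⟩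
    | cons y r => exact ⟨_, .refl _ _, _, subst_act_right _ _ p j l (y :: r), .inl rfl⟩

theorem Represents.red_of_step {M : Term} {c : Config 𝓜} (h : Represents M c)
    {t : (Fin 𝓜.q × Fin 𝓜.m × Dir) × (Fin 𝓜.q × Fin 𝓜.m × Dir)}
    (hc : 𝓜.δ c.state c.head = some t) :
    ∃ A A' B B', Red (2 * 𝓜.q + 2 * 𝓜.m + 22) M (choice A B) ∧
      Red (2 * 𝓜.m + 8) A A' ∧ Represents A' (move c t.1) ∧
      Red (2 * 𝓜.m + 8) B B' ∧ Represents B' (move c t.2) := by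
  have h₁ := h.red
  rw [lookup_code, hc, Option.map_some, handlerBody, subst] at h₁
  obtain ⟨A', hA, hA'⟩ := red_act c t.1
  obtain ⟨B', hB, hB'⟩ := red_act c t.2
  exact ⟨_, A', _, B', h₁, hA, hA', hB, hB'⟩

/-! ### Comparison of the halting and evaluation probabilities -/

/-- The probability that the machine halts within `k` steps with an output encoded by `V`. -/
noncomputable def haltWithin (V : Value) (c : Config 𝓜) (k : ℕ) : ℝ≥0∞ :=
  (MDist.run step k c).mass fun c => 𝓜.δ c.state c.head = none ∧ encString (tape c) = V

theorem step_eq_none {c : Config 𝓜} (hc : 𝓜.δ c.state c.head = none) : step c = none := by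
  simp [step, hc]

theorem haltWithin_mono (V : Value) (c : Config 𝓜) : Monotone (haltWithin V c) :=
  MDist.mass_run_mono (fun _ h => step_eq_none h.1) c

open Classical in
theorem haltWithin_of_final (V : Value) {c : Config 𝓜} (hc : 𝓜.δ c.state c.head = none) (k : ℕ) :
    haltWithin V c k = if encString (tape c) = V then 1 else 0 := by
  simp [haltWithin, MDist.mass_run_of_normal (step_eq_none hc), hc]

theorem haltWithin_zero (V : Value) {c : Config 𝓜} (hc : 𝓜.δ c.state c.head ≠ none) :
    haltWithin V c 0 = 0 := by
  classical
  simp [haltWithin, MDist.mass_run_zero, hc]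

theorem haltWithin_succ (V : Value) {c : Config 𝓜}
    {t : (Fin 𝓜.q × Fin 𝓜.m × Dir) × (Fin 𝓜.q × Fin 𝓜.m × Dir)}
    (hc : 𝓜.δ c.state c.head = some t) (k : ℕ) :
    haltWithin V c (k + 1) =
      2⁻¹ * haltWithin V (move c t.1) k + 2⁻¹ * haltWithin V (move c t.2) k := by
  have h : step c = some {(2⁻¹, move c t.1), (2⁻¹, move c t.2)} := by simp [step, hc]
  simp [haltWithin, MDist.mass_run_succ h]

theorem length_left_move (c : Config 𝓜) (t : Fin 𝓜.q × Fin 𝓜.m × Dir) :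
    (move c t).left.length ≤ c.left.length + 1 := by
  obtain ⟨st, l, x, r⟩ := c
  obtain ⟨p, j, _ | _ | _⟩ := t
  · cases l <;> simp [move]
    omega
  · simp [move]
  · cases r <;> simp [move]

/-- Every machine step costs the term at least one step, namely its choice, so the term is never
ahead of the machine. -/
theorem Represents.evalWithin_le {M : Term} {c : Config 𝓜} (h : Represents M c) (V : Value)
    (k : ℕ) : evalWithin M V k ≤ haltWithin V c k := by
  induction k generalizing M c with
  | zero =>
    cases hc : 𝓜.δ c.state c.head with
    | none =>
      rw [haltWithin_of_final V hc, ← evalWithin_ret _ _ 0]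
      exact (h.red_of_final hc).evalWithin_le V 0
    | some t =>
      obtain ⟨A, A', B, B', hM, -⟩ := h.red_of_step hc
      refine (hM.evalWithin_le V 0).trans ?_
      rw [evalWithin_choice_zero]
      exact zero_le
  | succ k ih =>
    cases hc : 𝓜.δ c.state c.head with
    | none =>
      rw [haltWithin_of_final V hc, ← evalWithin_ret _ _ (k + 1)]
      exact (h.red_of_final hc).evalWithin_le V _
    | some t =>
      obtain ⟨A, A', B, B', hM, hA, hA', hB, hB'⟩ := h.red_of_step hc
      refine (hM.evalWithin_le V _).trans ?_
      rw [evalWithin_choice_succ, haltWithin_succ V hc]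
      gcongr
      · exact (hA.evalWithin_le V k).trans (ih hA')
      · exact (hB.evalWithin_le V k).trans (ih hB')

/-- The slope adds `2 * q + 2 * m + 22` steps to reach the choice, 1 for the choice, `2 * m + 8` for
the action, and `2 * m + 14` to prepay the reversal of the one cell that the left string may gain.
The constant covers the last dispatch and the end of the reversal. -/
theorem Represents.haltWithin_le {M : Term} {c : Config 𝓜} (h : Represents M c) (V : Value)
    (k : ℕ) :
    haltWithin V c k ≤ evalWithin M V ((2 * 𝓜.q + 6 * 𝓜.m + 45) * k +
      (2 * 𝓜.m + 14) * c.left.length + (2 * 𝓜.q + 4 * 𝓜.m + 34)) := by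
  have final {M : Term} {c : Config 𝓜} (h : Represents M c) (hc : 𝓜.δ c.state c.head = none)
      (k : ℕ) : haltWithin V c k ≤ evalWithin M V ((2 * 𝓜.q + 6 * 𝓜.m + 45) * k +
        (2 * 𝓜.m + 14) * c.left.length + (2 * 𝓜.q + 4 * 𝓜.m + 34)) := by
    rw [haltWithin_of_final V hc, ← evalWithin_ret _ _ 0]
    exact ((h.red_of_final hc).le_evalWithin V 0).trans (evalWithin_mono _ _ (by omega))
  induction k generalizing M c with
  | zero =>
    cases hc : 𝓜.δ c.state c.head with
    | none => exact final h hc 0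
    | some t =>
      rw [haltWithin_zero V (by simp [hc])]
      exact zero_le
  | succ k ih =>
    cases hc : 𝓜.δ c.state c.head with
    | none => exact final h hc _
    | some t =>
      obtain ⟨A, A', B, B', hM, hA, hA', hB, hB'⟩ := h.red_of_step hc
      -- A budget that suffices for both successors, whose left strings have at most one more cell.
      set e := (2 * 𝓜.q + 6 * 𝓜.m + 45) * k + (2 * 𝓜.m + 14) * (c.left.length + 1) +
        (2 * 𝓜.q + 4 * 𝓜.m + 34) with he
      have branch {N N' : Term} {u : Fin 𝓜.q × Fin 𝓜.m × Dir} (hN : Red (2 * 𝓜.m + 8) N N')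
          (hN' : Represents N' (move c u)) :
          haltWithin V (move c u) k ≤ evalWithin N V (2 * 𝓜.m + 8 + e) := by
        refine (ih hN').trans ((evalWithin_mono _ _ ?_).trans (hN.le_evalWithin V e))
        have := Nat.mul_le_mul_left (2 * 𝓜.m + 14) (length_left_move c u)
        omega
      calc haltWithin V c (k + 1)
          ≤ evalWithin (choice A B) V (2 * 𝓜.m + 8 + e + 1) := by
            rw [evalWithin_choice_succ, haltWithin_succ V hc]
            gcongr
            · exact branch hA hA'
            · exact branch hB hB'
        _ ≤ evalWithin M V (2 * 𝓜.q + 2 * 𝓜.m + 22 + (2 * 𝓜.m + 8 + e + 1)) :=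
            hM.le_evalWithin V _
        _ ≤ _ := evalWithin_mono _ _ (by rw [he]; ring_nf; omega)

theorem evalWithin_simulator_le (s : List (Fin 𝓜.m)) (V : Value) (k : ℕ) :
    evalWithin (capp (simulator 𝓜.code) (encString s)) V k ≤ haltWithin V (initial 𝓜 s) k :=
  ((red_simulator _ _ _ s).evalWithin_le V k).trans ((represents_initial s).evalWithin_le V k)

theorem haltWithin_le_evalWithin_simulator (s : List (Fin 𝓜.m)) (V : Value) (k : ℕ) :
    haltWithin V (initial 𝓜 s) k ≤ evalWithin (capp (simulator 𝓜.code) (encString s)) V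
      ((2 * 𝓜.q + 6 * 𝓜.m + 45) * k + (2 * 𝓜.q + 4 * 𝓜.m + 36)) := by
  have h := (represents_initial s).haltWithin_le V k
  have hl : (initial 𝓜 s).left = [] := by cases s <;> rfl
  rw [hl] at h
  refine h.trans (((red_simulator _ _ _ s).le_evalWithin V _).trans (evalWithin_mono _ _ ?_))
  simp only [List.length_nil]
  omega

theorem haltWithin_encString (s w : List (Fin 𝓜.m)) (k : ℕ) :
    haltWithin (encString w) (initial 𝓜 s) k = outputWithin 𝓜 s w k := by
  simp only [haltWithin, outputWithin, encString_injective.eq_iff]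

theorem evalDist_simulator (s : List (Fin 𝓜.m)) (V : Value) :
    evalDist (capp (simulator 𝓜.code) (encString s)) V = ⨆ k, haltWithin V (initial 𝓜 s) k :=
  le_antisymm (iSup_mono (evalWithin_simulator_le s V))
    (iSup_le fun k => le_iSup_of_le _ (haltWithin_le_evalWithin_simulator s V k))

/-- By injectivity of the encoding the index type has at most one element; if it is empty, no
configuration contributes any mass. -/
theorem iSup_haltWithin (s : List (Fin 𝓜.m)) (V : Value) :
    ⨆ k, haltWithin V (initial 𝓜 s) k =
      ∑' w : {w : List (Fin 𝓜.m) // encString w = V}, outputDist 𝓜 s w := by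
  by_cases hV : ∃ w : List (Fin 𝓜.m), encString w = V
  · obtain ⟨w, rfl⟩ := hV
    rw [tsum_eq_single (⟨w, rfl⟩ : {w' : List (Fin 𝓜.m) // encString w' = encString w})
      fun w' hw' => absurd (Subtype.ext (encString_injective w'.2)) hw']
    simp only [haltWithin_encString, outputDist]
  · have : IsEmpty {w : List (Fin 𝓜.m) // encString w = V} := ⟨fun w => hV ⟨w.1, w.2⟩⟩
    rw [tsum_empty]
    have h (c : Config 𝓜) : ¬encString (tape c) = V := fun h => hV ⟨_, h⟩
    simp [haltWithin, h, MDist.mass]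

end PTM

/-! ### Effectiveness -/

namespace Lam

theorem iterate_upRen_of_lt (ξ : ℕ → ℕ) {n i : ℕ} (h : i < n) : upRen^[n] ξ i = i := by
  induction n generalizing i with
  | zero => omega
  | succ n ih =>
    rw [Function.iterate_succ_apply']
    cases i with
    | zero => rfl
    | succ i => simp [upRen, ih (i := i) (by omega)]

theorem iterate_upRen_add (ξ : ℕ → ℕ) (n i : ℕ) : upRen^[n] ξ (i + n) = ξ i + n := by
  induction n with
  | zero => rfl
  | succ n ih =>
    rw [Function.iterate_succ_apply', ← add_assoc]
    simp [upRen, ih, add_assoc]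

theorem rename_abss (ξ : ℕ → ℕ) (n : ℕ) (M : Term) :
    rename ξ (abss n M) = abss n (rename (upRen^[n] ξ) M) := by
  induction n generalizing ξ with
  | zero => rfl
  | succ n ih => simp [abss, rename, ih]

theorem rename_capp (ξ : ℕ → ℕ) (M : Term) (V : Value) :
    rename ξ (capp M V) = capp (rename ξ M) (rename ξ V) := by
  simp only [capp, rename, shift, rename_rename, upRen]
  rfl

/-- Strings with a variable tail are the only open arguments besides variables; their shift has the
same shape, so its code needs no recursion on syntax. -/
theorem shift_consV (m j n : ℕ) : shift (consV m j n) = consV m j (n + 1) := by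
  rw [consV, lam, shift, rename, rename_abss, ← Function.iterate_succ_apply, rename_capp, rename,
    rename, rename, iterate_upRen_of_lt _ (by omega), add_assoc, iterate_upRen_add]
  rfl

/-- The Gödel number of `capp M V` from those of `M` and of `shift V`. -/
def cappCode (x y : ℕ) : ℕ := Nat.pair 5 (Nat.pair x (Nat.pair 3 (Nat.pair (Nat.pair 0 0) y)))

theorem primrec_cappCode : Primrec₂ cappCode :=
  Primrec₂.natPair.comp (.const 5) (Primrec₂.natPair.comp .fst
    (Primrec₂.natPair.comp (.const 3) (Primrec₂.natPair.comp (.const _) .snd)))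

theorem code_apps (M : Term) (Vs : List Value) :
    code (apps M Vs) = (Vs.map fun V => code (shift V)).foldl cappCode (code M) := by
  induction Vs generalizing M with
  | nil => rfl
  | cons V Vs ih =>
    rw [apps_cons, ih]
    rfl

/-! ### Families of terms with primitive recursive Gödel numbers -/

variable {α : Type} [Primcodable α]

/-- A family of terms or values whose Gödel numbers are primitive recursive. -/
def PrimCode {c : Cat} (f : α → Lam c) : Prop := Primrec fun x => code (f x)

/-- A family of lists of values such that the Gödel numbers of the shifted values are primitive
recursive. -/
def PrimArgs (f : α → List Value) : Prop := Primrec fun x => (f x).map fun V => code (shift V)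

theorem primCode_const {c : Cat} (M : Lam c) : PrimCode fun _ : α => M := Primrec.const _

theorem PrimCode.comp {β : Type} [Primcodable β] {c : Cat} {f : α → Lam c} (hf : PrimCode f)
    {g : β → α} (hg : Primrec g) : PrimCode fun x => f (g x) :=
  Primrec.comp (f := fun y => code (f y)) hf hg

theorem primCode_var {n : α → ℕ} (hn : Primrec n) : PrimCode fun x => var (n x) :=
  Primrec₂.natPair.comp (.const 0) hn

theorem PrimCode.ret {V : α → Value} (hV : PrimCode V) : PrimCode fun x => ret (V x) :=
  Primrec₂.natPair.comp (.const 2) hV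

theorem PrimCode.choice {M N : α → Term} (hM : PrimCode M) (hN : PrimCode N) :
    PrimCode fun x => choice (M x) (N x) :=
  Primrec₂.natPair.comp (.const 4) (Primrec₂.natPair.comp hM hN)

theorem PrimCode.ite {c : Cat} {p : α → Prop} [DecidablePred p] (hp : PrimrecPred p)
    {M N : α → Lam c} (hM : PrimCode M) (hN : PrimCode N) :
    PrimCode fun x => if p x then M x else N x :=
  (Primrec.ite hp hM hN).of_eq fun x => by dsimp only; split_ifs <;> rfl

protected theorem PrimCode.lam {n : α → ℕ} {M : α → Term} (hn : Primrec n) (hM : PrimCode M) :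
    PrimCode fun x => lam (n x) (M x) := by
  have h : Primrec fun y : ℕ => Nat.pair 2 (Nat.pair 1 y) :=
    Primrec₂.natPair.comp (.const 2) (Primrec₂.natPair.comp (.const 1) .id)
  refine (Primrec₂.natPair.comp (.const 1)
    (Primrec.nat_iterate hn hM (h.comp Primrec.snd).to₂)).of_eq fun x => ?_
  have (n : ℕ) (M : Term) :
      code (abss n M) = (fun y => Nat.pair 2 (Nat.pair 1 y))^[n] (code M) := by
    induction n with
    | zero => rfl
    | succ n ih => rw [Function.iterate_succ_apply', ← ih, abss, code, code]
  simp only [Lam.lam, code, this]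

theorem PrimCode.apps {M : α → Term} {Vs : α → List Value} (hM : PrimCode M) (hVs : PrimArgs Vs) :
    PrimCode fun x => apps (M x) (Vs x) :=
  (Primrec.list_foldl hVs hM
    (primrec_cappCode.comp (Primrec.fst.comp .snd) (Primrec.snd.comp .snd)).to₂).of_eq
    fun _ => (code_apps _ _).symm

theorem primArgs_nil : PrimArgs fun _ : α => [] := Primrec.const _

theorem PrimArgs.cons {V : α → Value} {Vs : α → List Value} (hV : PrimCode fun x => shift (V x))
    (hVs : PrimArgs Vs) : PrimArgs fun x => V x :: Vs x :=
  Primrec.list_cons.comp hV hVs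

/-- `capp` stores the shifted argument, whose code is not directly a function of the argument's
code; for closed values the shift disappears. -/
theorem PrimArgs.cons_closed {V : α → Value} {Vs : α → List Value} (hV : PrimCode V)
    (hc : ∀ x, Closed (V x)) (hVs : PrimArgs Vs) : PrimArgs fun x => V x :: Vs x :=
  .cons (by simpa only [(hc _).shift_eq] using hV) hVs

theorem PrimArgs.cons_var (n : ℕ) {Vs : α → List Value} (hVs : PrimArgs Vs) :
    PrimArgs fun x => var n :: Vs x :=
  .cons (primCode_const _) hVs

theorem PrimArgs.append {Vs Ws : α → List Value} (hVs : PrimArgs Vs) (hWs : PrimArgs Ws) :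
    PrimArgs fun x => Vs x ++ Ws x :=
  (Primrec.list_append.comp hVs hWs).of_eq fun x => by simp

theorem primArgs_branches {n : α → ℕ} {f : α → ℕ → Value} {V : α → Value} (hn : Primrec n)
    (hf : PrimCode fun y : α × ℕ => f y.1 y.2) (hfc : ∀ x i, Closed (f x i))
    (hV : PrimCode V) (hVc : ∀ x, Closed (V x)) :
    PrimArgs fun x => branches (n x) (f x) (V x) := by
  refine PrimArgs.append (Vs := fun x => (List.range (n x)).map (f x)) ?_
    (primArgs_nil.cons_closed hV hVc)
  refine (Primrec.list_map (Primrec.list_range.comp hn) (Primrec.to₂ hf)).of_eq fun x => ?_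
  simp [(hfc x _).shift_eq]

variable {m q b p i n : α → ℕ}

theorem primCode_nilV (hm : Primrec m) : PrimCode fun x => nilV (m x) :=
  .lam hm (primCode_const _)

theorem primCode_consV (hm : Primrec m) (hi : Primrec i) (n : ℕ) :
    PrimCode fun x => consV (m x) (i x) n :=
  have h : PrimCode fun x => shift (var (n + m x + 1)) := by
    simpa only [shift, rename] using primCode_var (Primrec.succ.comp (Primrec.succ.comp
      (Primrec.nat_add.comp (.const n) hm)))
  .lam hm (.apps (.ret (primCode_var (Primrec.nat_sub.comp hm hi))) (.cons h primArgs_nil))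

theorem PrimArgs.cons_consV (hm : Primrec m) (hi : Primrec i) (n : ℕ) {Vs : α → List Value}
    (hVs : PrimArgs Vs) : PrimArgs fun x => consV (m x) (i x) n :: Vs x :=
  .cons (by simpa only [shift_consV] using primCode_consV hm hi (n + 1)) hVs

theorem primCode_sel (hq : Primrec q) (hp : Primrec p) : PrimCode fun x => sel (q x) (p x) :=
  .lam hq (.ret (primCode_var (Primrec.nat_sub.comp hq hp)))

theorem PrimArgs.cons_sel (hq : Primrec q) (hp : Primrec p) {Vs : α → List Value}
    (hVs : PrimArgs Vs) : PrimArgs fun x => sel (q x) (p x) :: Vs x :=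
  hVs.cons_closed (primCode_sel hq hp) fun _ => closed_sel _ _

theorem PrimArgs.cons_nilV (hm : Primrec m) {Vs : α → List Value} (hVs : PrimArgs Vs) :
    PrimArgs fun x => nilV (m x) :: Vs x :=
  hVs.cons_closed (primCode_nilV hm) fun _ => closed_nilV _

theorem primCode_moveLeftCons (hm : Primrec m) (hq : Primrec q) (hp : Primrec p) (hi : Primrec i) :
    PrimCode fun x => moveLeftCons (m x) (q x) (p x) (i x) :=
  .lam (.const 2) (.apps (primCode_const _)
    ((((primArgs_nil.cons_consV hm hi 0).cons_var 2).cons_var 1).cons_sel hq hp))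

theorem primCode_moveLeftNil (hm : Primrec m) (hq : Primrec q) (hb : Primrec b) (hp : Primrec p) :
    PrimCode fun x => moveLeftNil (m x) (q x) (b x) (p x) :=
  .lam (.const 1) (.apps (primCode_const _)
    ((((primArgs_nil.cons_consV hm hb 0).cons_nilV hm).cons_var 1).cons_sel hq hp))

theorem primCode_act {t : α → ℕ × ℕ × ℕ} (hm : Primrec m) (hq : Primrec q) (hb : Primrec b)
    (ht : Primrec t) : PrimCode fun x => act (m x) (q x) (b x) (t x) := by
  have hp := Primrec.fst.comp ht
  have hj := Primrec.fst.comp (Primrec.snd.comp ht)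
  have hd := Primrec.snd.comp (Primrec.snd.comp ht)
  refine .ite (Primrec.eq.comp hd (.const 0)) (.apps (primCode_const _) (.append ?_ ?_))
    (.ite (Primrec.eq.comp hd (.const 1)) (.apps (primCode_const _) ?_)
      (.apps (primCode_const _) ?_))
  · exact primArgs_branches hm
      (primCode_moveLeftCons (hm.comp .fst) (hq.comp .fst) (hp.comp .fst) .snd)
      (fun _ _ => closed_moveLeftCons _ _ _ _) (primCode_moveLeftNil hm hq hb hp)
      (fun _ => closed_moveLeftNil _ _ _ _)
  · exact (primArgs_nil.cons_consV hm hj 2).cons_var 1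
  · exact (((primArgs_nil.cons_consV hm hj 2).cons_var 0).cons_var 1).cons_sel hq hp
  · exact (((primArgs_nil.cons_var 2).cons_consV hm hj 0).cons_var 1).cons_sel hq hp

theorem primCode_rev (hm : Primrec m) : PrimCode fun x => rev (m x) :=
  .lam (.const 2) (.apps (primCode_const _) (.append
    (primArgs_branches hm
      (.lam (.const 2) (.apps (primCode_const _)
        (((primArgs_nil.cons_consV (hm.comp .fst) .snd 0).cons_var 2).cons_var 1)))
      (fun _ _ => closed_revCons _ _) (primCode_const _) (fun _ => closed_revNil))
    ((primArgs_nil.cons_var 0).cons_var 2)))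

theorem primCode_handlerBody {o : α → Option ((ℕ × ℕ × ℕ) × (ℕ × ℕ × ℕ))} (hm : Primrec m)
    (hq : Primrec q) (hb : Primrec b) (hi : Primrec i) (ho : Primrec o) :
    PrimCode fun x => handlerBody (m x) (q x) (b x) (i x) (o x) := by
  have hnone : PrimCode fun x => apps (ret (rev (m x))) [rev (m x), var 0, consV (m x) (i x) 2] :=
    .apps (.ret (primCode_rev hm)) (((primArgs_nil.cons_consV hm hi 2).cons_var 0).cons_closed
      (primCode_rev hm) fun _ => closed_rev _)
  have hsome : PrimCode fun y : α × ((ℕ × ℕ × ℕ) × (ℕ × ℕ × ℕ)) =>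
      Lam.choice (act (m y.1) (q y.1) (b y.1) y.2.1) (act (m y.1) (q y.1) (b y.1) y.2.2) :=
    .choice
      (primCode_act (hm.comp .fst) (hq.comp .fst) (hb.comp .fst) (Primrec.fst.comp .snd))
      (primCode_act (hm.comp .fst) (hq.comp .fst) (hb.comp .fst) (Primrec.snd.comp .snd))
  refine (Primrec.option_casesOn ho hnone (Primrec.to₂ hsome)).of_eq fun x => ?_
  dsimp only
  cases o x <;> rfl

end Lam

namespace PTM

open Lam

/-! ### Primitive recursiveness of the simulating term in the code of the machine -/

theorem primrec_lookup : Primrec fun y : Code × ℕ × ℕ => lookup y.1 y.2.1 y.2.2 :=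
  (Primrec.list_getD none).comp
    ((Primrec.list_getD []).comp
      (Primrec.snd.comp (Primrec.snd.comp (Primrec.snd.comp (Primrec.snd.comp Primrec.fst))))
      (Primrec.fst.comp Primrec.snd))
    (Primrec.snd.comp Primrec.snd)

theorem primCode_handler : PrimCode fun y : Code × ℕ × ℕ =>
    handler y.1.1 y.1.2.1 y.1.2.2.1 (lookup y.1) y.2.1 y.2.2 :=
  .lam (.const 2) (primCode_handlerBody (Primrec.fst.comp .fst)
    (Primrec.fst.comp (Primrec.snd.comp .fst))
    (Primrec.fst.comp (Primrec.snd.comp (Primrec.snd.comp .fst)))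
    (Primrec.snd.comp .snd) primrec_lookup)

theorem primCode_blankHandler : PrimCode fun y : Code × ℕ =>
    blankHandler y.1.1 y.1.2.1 y.1.2.2.1 (lookup y.1) y.2 := by
  have h : Primrec fun y : Code × ℕ => (y.1, y.2, y.1.2.2.1) :=
    .pair .fst (.pair .snd (Primrec.fst.comp (Primrec.snd.comp (Primrec.snd.comp .fst))))
  have h₁ := (primCode_handler.comp h).ret
  have h₂ := h₁.apps (((primArgs_nil.cons_var 0).cons_var 1).cons_nilV (Primrec.fst.comp .fst))
  exact h₂.lam (.const 1)

theorem primCode_stateV : PrimCode fun y : Code × ℕ =>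
    stateV y.1.1 y.1.2.1 y.1.2.2.1 (lookup y.1) y.2 := by
  have h : Primrec fun y : (Code × ℕ) × ℕ => (y.1.1, y.1.2, y.2) :=
    .pair (Primrec.fst.comp .fst) (.pair (Primrec.snd.comp .fst) .snd)
  have h₀ := primCode_handler.comp h
  have h₁ : PrimArgs fun y : Code × ℕ => branches y.1.1
      (handler y.1.1 y.1.2.1 y.1.2.2.1 (lookup y.1) y.2)
      (blankHandler y.1.1 y.1.2.1 y.1.2.2.1 (lookup y.1) y.2) := by
    refine primArgs_branches (Primrec.fst.comp .fst) h₀ ?_ primCode_blankHandler ?_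
    · exact fun _ _ => closed_handler _ _ _ _ _ _
    · exact fun _ => closed_blankHandler _ _ _ _ _
  have h₂ := (primCode_const (ret (var 0))).apps
    (h₁.append ((primArgs_nil.cons_var 1).cons_var 2))
  exact h₂.lam (.const 2)

theorem primCode_table : PrimCode fun c : Code => table c.1 c.2.1 c.2.2.1 (lookup c) :=
  .lam (.const 0) (.apps (primCode_const _)
    (primArgs_branches (Primrec.fst.comp .snd) primCode_stateV
      (fun _ _ => closed_stateV _ _ _ _ _) (primCode_nilV .fst) (fun _ => closed_nilV _)))

theorem primCode_simulator : PrimCode simulator :=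
  .ret (.lam (.const 0) (.apps (.ret primCode_table)
    ((((primArgs_nil.cons_var 0).cons_nilV .fst).cons_closed primCode_table
      fun _ => closed_table _ _ _ _).cons_sel (Primrec.fst.comp .snd)
        (Primrec.fst.comp (Primrec.snd.comp (Primrec.snd.comp .snd))))))

end PTM

/-! ### The main theorem -/

theorem mainTheorem8 :
    ∃ T : PTM → Lam.Term,
      (∃ F : PTM.Code → ℕ, Computable F ∧ ∀ 𝓜 : PTM, F 𝓜.code = (T 𝓜).code) ∧
      ∀ 𝓜 : PTM, (T 𝓜).IsCPS ∧ (T 𝓜).Closed ∧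
        (∀ (s : List (Fin 𝓜.m)) (V : Lam.Value),
          (Lam.capp (T 𝓜) (Lam.encString s)).evalDist V =
            ∑' w : {w : List (Fin 𝓜.m) // Lam.encString w = V}, 𝓜.outputDist s w) ∧
        ∃ a b : ℕ, ∀ (s w : List (Fin 𝓜.m)) (k : ℕ),
          𝓜.outputWithin s w k ≤
              (Lam.capp (T 𝓜) (Lam.encString s)).evalWithin (Lam.encString w) (a * k + b) ∧
            (Lam.capp (T 𝓜) (Lam.encString s)).evalWithin (Lam.encString w) k ≤
              𝓜.outputWithin s w (a * k + b) := by
  refine ⟨fun 𝓜 => PTM.simulator 𝓜.code,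
    ⟨_, PTM.primCode_simulator.to_comp, fun _ => rfl⟩, fun 𝓜 =>
    ⟨Lam.isCPS_simulator _ _ _ _ _, Lam.closed_simulator _ _ _ _ _, fun s V => ?_,
      2 * 𝓜.q + 6 * 𝓜.m + 45, 2 * 𝓜.q + 4 * 𝓜.m + 36, fun s w k => ?_⟩⟩
  · rw [PTM.evalDist_simulator, PTM.iSup_haltWithin]
  · rw [← PTM.haltWithin_encString, ← PTM.haltWithin_encString]
    refine ⟨PTM.haltWithin_le_evalWithin_simulator s _ k,
      (PTM.evalWithin_simulator_le s _ k).trans (PTM.haltWithin_mono _ _ ?_)⟩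
    -- The bound on the term already holds with budget `k`; what remains is that `k` is at most `a *
    -- k + b`.
    nlinarith
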